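/- Let $p$ be a prime with $p\equiv\pm1\pmod{10}$, let $n$ be a natural number with $p<2^n$, and put $S=p^2\cdot16^n+1$ and $\alpha=p\cdot4^n+i\in\mathbb Z[i]$. Let $E_{30}$ be the elliptic curve $30y^2=x^3-x$ over $\mathbb Q(i)$. The group $E_{30}(\mathbb Q(i))$ is a $\mathbb Z[i]$-module, where $i$ acts by $(x,y)\mapsto(-x,iy)$. Let $Q=p\cdot(5,2)\in E_{30}(\mathbb Q(i))$. An element of $\mathbb Q(i)$ has a residue modulo $\alpha$ if it can be written as $a/d$ with $a,d\in\mathbb Z[i]$ and $d$ coprime to $\alpha$; its residue is then $a\,d^{-1}\in\mathbb Z[i]/(\alpha)$. The following hold. 1. $S$ is prime if and only if $(1+i)^{4n-1}Q\equiv(0,0)\pmod{\alpha}$, that is, $(1+i)^{4n-1}Q$ is an affine point both of whose coordinates have residue $0$ modulo $\alpha$. 2. $S$ is prime if and only if the $x$-coordinate of $Q$ has a residue $x_0$ modulo $\alpha$, the iteration $$x_{j+1}=\frac{i(1-x_j^2)}{2x_j}\quad\text{in }\mathbb Z[i]/(\alpha)$$ is well defined for $4n-1$ steps (that is, $2x_j$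 is invertible in $\mathbb Z[i]/(\alpha)$ for all $0\le j<4n-1$), and $x_{4n-1}=0$ in $\mathbb Z[i]/(\alpha)$. -/

import Mathlib

/-- The `K`-rational points of (the projective closure of) the curve `E₃₀ : 30 y² = x³ - x`:
the point at infinity, and the affine points. -/
inductive E30 (K : Type*) [Field K] : Type _
  | infty : E30 K
  | affine (x y : K) (h : 30 * y ^ 2 = x ^ 3 - x) : E30 K

noncomputable section

namespace E30

variable {K : Type*} [Field K]

open Classical in
/-- The slope of the line through the points `(x₁, y₁)` and `(x₂, y₂)` of `E₃₀`, and of the tangent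
line if the two points are equal (only used when the two points are not opposite). -/
def slope (x₁ y₁ x₂ y₂ : K) : K :=
  if x₁ = x₂ then (3 * x₁ ^ 2 - 1) / (60 * y₁) else (y₁ - y₂) / (x₁ - x₂)

/-- The third intersection point of the line is on the curve. -/
theorem add_mem {x₁ y₁ x₂ y₂ : K} [h30 : NeZero (30 : K)] (h₁ : 30 * y₁ ^ 2 = x₁ ^ 3 - x₁)
    (h₂ : 30 * y₂ ^ 2 = x₂ ^ 3 - x₂) (h : ¬(x₁ = x₂ ∧ y₁ = -y₂)) :
    30 * (slope x₁ y₁ x₂ y₂ * (x₁ - (30 * slope x₁ y₁ x₂ y₂ ^ 2 - x₁ - x₂)) - y₁) ^ 2 =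
      (30 * slope x₁ y₁ x₂ y₂ ^ 2 - x₁ - x₂) ^ 3 - (30 * slope x₁ y₁ x₂ y₂ ^ 2 - x₁ - x₂) := by
  have h30 : (30 : K) ≠ 0 := NeZero.ne _
  by_cases hx : x₁ = x₂
  · subst hx
    have hy : y₁ = y₂ := by
      have h0 : (30 : K) * ((y₁ - y₂) * (y₁ + y₂)) = 0 := by linear_combination h₁ - h₂
      rcases mul_eq_zero.1 ((mul_eq_zero.1 h0).resolve_left h30) with h' | h'
      · exact sub_eq_zero.1 h'
      · exact absurd ⟨rfl, eq_neg_of_add_eq_zero_left h'⟩ h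
    subst hy
    have h2 : (2 : K) ≠ 0 := by
      intro h2
      exact h30 (by linear_combination 15 * h2)
    have hy0 : y₁ ≠ 0 := by
      rintro rfl
      exact h ⟨rfl, by simp⟩
    have hl : 2 * (30 * y₁ * slope x₁ y₁ x₁ y₁) = 3 * x₁ ^ 2 - 1 := by
      have h60 : (60 : K) * y₁ ≠ 0 :=
        mul_ne_zero (by rw [show (60 : K) = 2 * 30 by norm_num]; exact mul_ne_zero h2 h30) hy0
      rw [slope, if_pos rfl, ← mul_div_assoc, ← mul_div_assoc, div_eq_iff h60]
      ring
    generalize slope x₁ y₁ x₁ y₁ = l at hl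
    linear_combination h₁ + (30 * l ^ 2 - 3 * x₁) * hl
  · have hd : x₁ - x₂ ≠ 0 := sub_ne_zero.2 hx
    have hl : slope x₁ y₁ x₂ y₂ * (x₁ - x₂) = y₁ - y₂ := by
      rw [slope, if_neg hx, div_mul_cancel₀ _ hd]
    generalize slope x₁ y₁ x₂ y₂ = l at hl
    obtain rfl : y₂ = y₁ - l * (x₁ - x₂) := by linear_combination hl
    apply mul_right_cancel₀ hd
    linear_combination (30 * l ^ 2 - x₁ - x₂ - x₂) * h₁ - (30 * l ^ 2 - x₁ - x₂ - x₁) * h₂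

/-- The image in `K` of the imaginary unit `i ∈ ℤ[i]`. -/
def imag (K : Type*) [Field K] [Algebra GaussianInt K] : K :=
  algebraMap GaussianInt K ⟨0, 1⟩

theorem imag_sq [Algebra GaussianInt K] : imag K ^ 2 = -1 := by
  rw [imag, ← map_pow, show (⟨0, 1⟩ : GaussianInt) ^ 2 = -1 by decide, map_neg, map_one]

variable [NeZero (30 : K)]

open Classical in
/-- The chord-tangent addition on `E₃₀`, with the point at infinity as neutral element. -/
protected def add : E30 K → E30 K → E30 K
  | infty, P => P
  | P, infty => P
  | affine x₁ y₁ h₁, affine x₂ y₂ h₂ =>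
    if h : x₁ = x₂ ∧ y₁ = -y₂ then infty
    else affine (30 * slope x₁ y₁ x₂ y₂ ^ 2 - x₁ - x₂)
      (slope x₁ y₁ x₂ y₂ * (x₁ - (30 * slope x₁ y₁ x₂ y₂ ^ 2 - x₁ - x₂)) - y₁)
      (add_mem h₁ h₂ h)

/-- The reflection `(x, y) ↦ (x, -y)`. -/
protected def neg : E30 K → E30 K
  | infty => infty
  | affine x y h => affine x (-y) (by rw [neg_sq, h])

instance : Zero (E30 K) := ⟨infty⟩
instance : Add (E30 K) := ⟨E30.add⟩
instance : Neg (E30 K) := ⟨E30.neg⟩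

/-- The Weierstrass curve `Y² = X³ - 900 X`, isomorphic to `E₃₀` through
`(x, y) ↦ (30 x, 900 y)`; it is only used to prove that the addition above is associative. -/
def W (K : Type*) [Field K] : WeierstrassCurve.Affine K := ⟨0, 0, 0, -900, 0⟩

theorem W_nonsingular {x y : K} (h : 30 * y ^ 2 = x ^ 3 - x) :
    (W K).Nonsingular (30 * x) (900 * y) := by
  have h30 : (30 : K) ≠ 0 := NeZero.ne _
  rw [← WeierstrassCurve.Affine.equation_iff_nonsingular_of_Δ_ne_zero]
  · rw [WeierstrassCurve.Affine.equation_iff]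
    simp only [W]
    linear_combination 27000 * h
  · have h2 : (2 : K) ≠ 0 := by
      intro h2
      exact h30 (by linear_combination 15 * h2)
    have : (W K).Δ = 2 ^ 6 * 30 ^ 6 := by
      simp only [WeierstrassCurve.Δ, WeierstrassCurve.b₂, WeierstrassCurve.b₄,
        WeierstrassCurve.b₆, WeierstrassCurve.b₈, W]
      norm_num
    rw [this]
    exact mul_ne_zero (pow_ne_zero _ h2) (pow_ne_zero _ h30)

/-- The change of variables `(x, y) ↦ (30 x, 900 y)`. -/
def toW : E30 K → (W K).Point
  | infty => 0
  | affine x y h => .some (30 * x) (900 * y) (W_nonsingular h)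

theorem toW_injective : Function.Injective (toW (K := K)) := by
  have h30 : (30 : K) ≠ 0 := NeZero.ne _
  have h900 : (900 : K) ≠ 0 := by
    rw [show (900 : K) = 30 * 30 by norm_num]; exact mul_ne_zero h30 h30
  rintro (_ | ⟨x, y, h⟩) (_ | ⟨x', y', h'⟩) he
  · rfl
  · cases he
  · cases he
  · simp only [toW, WeierstrassCurve.Affine.Point.some.injEq] at he
    obtain rfl := mul_left_cancel₀ h30 he.1
    obtain rfl := mul_left_cancel₀ h900 he.2
    rfl

open Classical in
theorem toW_add (P Q : E30 K) : toW (P + Q) = toW P + toW Q := by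
  have h30 : (30 : K) ≠ 0 := NeZero.ne _
  have h900 : (900 : K) ≠ 0 := by
    rw [show (900 : K) = 30 * 30 by norm_num]; exact mul_ne_zero h30 h30
  have h2 : (2 : K) ≠ 0 := by
    intro h2
    exact h30 (by linear_combination 15 * h2)
  obtain _ | ⟨x₁, y₁, h₁⟩ := P
  · exact (zero_add (toW Q)).symm
  obtain _ | ⟨x₂, y₂, h₂⟩ := Q
  · exact (add_zero (toW (affine x₁ y₁ h₁))).symm
  change toW (E30.add (affine x₁ y₁ h₁) (affine x₂ y₂ h₂)) = _
  have hn : (W K).negY (30 * x₂) (900 * y₂) = 900 * -y₂ := by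
    simp [W, WeierstrassCurve.Affine.negY]
  by_cases h : x₁ = x₂ ∧ y₁ = -y₂
  · rw [E30.add, dif_pos h]
    simp only [toW]
    rw [WeierstrassCurve.Affine.Point.add_of_Y_eq (by rw [h.1]) (by rw [hn, h.2])]
  · have hs : (W K).slope (30 * x₁) (30 * x₂) (900 * y₁) (900 * y₂) =
        30 * slope x₁ y₁ x₂ y₂ := by
      by_cases hx : x₁ = x₂
      · subst hx
        have hy : y₁ = y₂ := by
          have h0 : (30 : K) * ((y₁ - y₂) * (y₁ + y₂)) = 0 := by linear_combination h₁ - h₂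
          rcases mul_eq_zero.1 ((mul_eq_zero.1 h0).resolve_left h30) with h' | h'
          · exact sub_eq_zero.1 h'
          · exact absurd ⟨rfl, eq_neg_of_add_eq_zero_left h'⟩ h
        subst hy
        have hy0 : y₁ ≠ 0 := by
          rintro rfl
          exact h ⟨rfl, by simp⟩
        rw [WeierstrassCurve.Affine.slope_of_Y_ne rfl, slope, if_pos rfl]
        · simp only [WeierstrassCurve.Affine.negY, W]
          rw [show (60 : K) = 2 * 30 by norm_num,
            show (900 : K) * y₁ - (-(900 * y₁) - 0 * (30 * x₁) - 0) = 2 * (30 * 30) * y₁ by ring]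
          field_simp
          ring
        · rw [hn]
          intro h'
          exact h ⟨rfl, mul_left_cancel₀ h900 h'⟩
      · rw [WeierstrassCurve.Affine.slope_of_X_ne (fun h' => hx (mul_left_cancel₀ h30 h')),
          slope, if_neg hx, ← mul_sub, ← mul_sub, show (900 : K) = 30 * 30 by norm_num]
        have hd : x₁ - x₂ ≠ 0 := sub_ne_zero.2 hx
        field_simp
    rw [E30.add, dif_neg h]
    simp only [toW]
    rw [WeierstrassCurve.Affine.Point.add_some
      (fun h' => h ⟨mul_left_cancel₀ h30 h'.1, mul_left_cancel₀ h900 (h'.2.trans hn)⟩)]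
    rw [WeierstrassCurve.Affine.Point.some.injEq, hs]
    simp only [WeierstrassCurve.Affine.addX,
      WeierstrassCurve.Affine.addY, WeierstrassCurve.Affine.negAddY,
      WeierstrassCurve.Affine.negY, W]
    constructor <;> ring

theorem neg_add_self' (P : E30 K) : -P + P = 0 := by
  obtain _ | ⟨x, y, h⟩ := P
  · rfl
  · change E30.add (affine x (-y) _) (affine x y h) = infty
    rw [E30.add, dif_pos ⟨rfl, rfl⟩]

/-- The chord-tangent addition makes `E₃₀(K)` an abelian group. -/
instance : AddCommGroup (E30 K) where
  add_assoc P Q R := by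
    classical exact toW_injective (by simp only [toW_add, add_assoc])
  zero_add P := by
    classical exact toW_injective (by rw [toW_add]; exact zero_add (toW P))
  add_zero P := by
    classical exact toW_injective (by rw [toW_add]; exact add_zero (toW P))
  add_comm P Q := by
    classical exact toW_injective (by rw [toW_add, toW_add, add_comm])
  neg_add_cancel := neg_add_self'
  nsmul := nsmulRec
  zsmul := zsmulRec

variable [Algebra GaussianInt K]

/-- Multiplication by `i` on `E₃₀`: the automorphism `(x, y) ↦ (-x, i y)`. -/
def mulI : E30 K → E30 K
  | infty => infty
  | affine x y h => affine (-x) (imag K * y) (by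
      linear_combination 30 * y ^ 2 * imag_sq (K := K) - h)

theorem mulI_add (P Q : E30 K) : mulI (P + Q) = mulI P + mulI Q := by
  have hI := imag_sq (K := K)
  have hI0 : imag K ≠ 0 := by
    intro h0
    rw [h0] at hI
    norm_num at hI
  obtain _ | ⟨x₁, y₁, h₁⟩ := P
  · exact (zero_add (mulI Q)).symm
  obtain _ | ⟨x₂, y₂, h₂⟩ := Q
  · exact (add_zero (mulI (affine x₁ y₁ h₁))).symm
  change mulI (E30.add _ _) = E30.add (affine _ _ _) (affine _ _ _)
  by_cases h : x₁ = x₂ ∧ y₁ = -y₂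
  · rw [E30.add, dif_pos h, E30.add, dif_pos (by rw [h.1, h.2]; simp)]
    rfl
  · have h' : ¬(-x₁ = -x₂ ∧ imag K * y₁ = -(imag K * y₂)) := fun h' =>
      h ⟨neg_injective h'.1, mul_left_cancel₀ hI0 (by rw [h'.2, mul_neg])⟩
    have hs : slope (-x₁) (imag K * y₁) (-x₂) (imag K * y₂) = -imag K * slope x₁ y₁ x₂ y₂ := by
      by_cases hx : x₁ = x₂
      · rw [slope, slope, if_pos hx, if_pos (by rw [hx])]
        rw [show 60 * (imag K * y₁) = imag K * (60 * y₁) by ring, neg_sq, ← div_div,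
          ← mul_div_assoc]
        congr 1
        field_simp
        linear_combination (3 * x₁ ^ 2 - 1) * hI
      · rw [slope, slope, if_neg hx, if_neg (fun h' => hx (neg_injective h')),
          ← mul_sub, ← mul_div_assoc, show -x₁ - -x₂ = -(x₁ - x₂) by ring, div_neg, neg_mul,
          neg_div]
    rw [E30.add, dif_neg h, E30.add, dif_neg h']
    simp only [mulI, affine.injEq, hs]
    generalize slope x₁ y₁ x₂ y₂ = l
    constructor
    · linear_combination -30 * l ^ 2 * hI
    · linear_combination (-30) * l ^ 3 * imag K * hI

theorem mulI_mulI (P : E30 K) : mulI (mulI P) = -P := by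
  obtain _ | ⟨x, y, h⟩ := P
  · rfl
  · change affine _ _ _ = affine _ _ _
    simp only [affine.injEq, neg_neg, true_and]
    linear_combination y * imag_sq (K := K)

/-- `mulI` as a homomorphism of groups. -/
def mulIHom (K : Type*) [Field K] [NeZero (30 : K)] [Algebra GaussianInt K] : E30 K →+ E30 K where
  toFun := mulI
  map_zero' := rfl
  map_add' := mulI_add

/-- The `ℤ[i]`-module structure of `E₃₀(K)`: the Gaussian integer `a + b i` acts as
`P ↦ a P + b (i P)`. -/
instance : Module GaussianInt (E30 K) where
  smul z P := z.re • P + z.im • mulIHom K P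
  one_smul P := by
    change (1 : ℤ) • P + (0 : ℤ) • mulIHom K P = P
    simp
  mul_smul z w P := by
    change (z * w).re • P + (z * w).im • mulIHom K P =
      z.re • (w.re • P + w.im • mulIHom K P) +
        z.im • mulIHom K (w.re • P + w.im • mulIHom K P)
    have hh : mulIHom K (mulIHom K P) = -P := mulI_mulI P
    simp only [map_add, map_zsmul, hh, Zsqrtd.re_mul, Zsqrtd.im_mul]
    module
  smul_zero z := by
    change z.re • (0 : E30 K) + z.im • mulIHom K 0 = 0
    simp
  smul_add z P Q := by
    change z.re • (P + Q) + z.im • mulIHom K (P + Q) =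
      (z.re • P + z.im • mulIHom K P) + (z.re • Q + z.im • mulIHom K Q)
    simp only [map_add]
    module
  add_smul z w P := by
    change (z + w).re • P + (z + w).im • mulIHom K P =
      (z.re • P + z.im • mulIHom K P) + (w.re • P + w.im • mulIHom K P)
    simp only [Zsqrtd.re_add, Zsqrtd.im_add]
    module
  zero_smul P := by
    change (0 : ℤ) • P + (0 : ℤ) • mulIHom K P = 0
    simp

end E30

/-- The field `ℚ(i)`, as the field of fractions of `ℤ[i]`. -/
abbrev QI : Type := FractionRing GaussianInt

instance : NeZero (30 : QI) := by
  have : CharZero QI :=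
    charZero_of_injective_algebraMap (IsFractionRing.injective GaussianInt QI)
  exact ⟨by norm_num⟩

/-- The residue ring `ℤ[i]/(α)`. -/
abbrev ResidueRing (α : GaussianInt) : Type := GaussianInt ⧸ Ideal.span {α}

/-- `x ∈ ℚ(i)` is integral at `α` with residue `c` modulo `α`: `x = a / d` where the denominator `d`
is coprime to `α`, and `c` is the quotient of the residues of `a` and `d`. -/
def ReducesTo (α : GaussianInt) (x : QI) (c : ResidueRing α) : Prop :=
  ∃ a d : GaussianInt, IsCoprime d α ∧
    algebraMap GaussianInt QI d * x = algebraMap GaussianInt QI a ∧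
    Ideal.Quotient.mk (Ideal.span {α}) d * c = Ideal.Quotient.mk (Ideal.span {α}) a

/-- The point `P ∈ E₃₀(ℚ(i))` is congruent modulo `α` to the affine point with coordinates
`(a, b)`: `P` is not at infinity modulo any divisor of `α`, and its coordinates reduce
to `a` and `b`. (For `α` coprime to `30`, this is equality in `E₃₀(ℤ[i]/(α))`.) -/
def PointCongr (α : GaussianInt) (P : E30 QI) (a b : ResidueRing α) : Prop :=
  ∃ (x y : QI) (h : 30 * y ^ 2 = x ^ 3 - x),
    P = E30.affine x y h ∧ ReducesTo α x a ∧ ReducesTo α y b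

/-- One step `x' = i (1 - x²) / (2 x)` of the iteration in `ℤ[i]/(α)`, including that it is defined,
that is, that the denominator `2 x` is invertible. -/
def IterStep (α : GaussianInt) (x x' : ResidueRing α) : Prop :=
  IsUnit (2 * x) ∧ 2 * x * x' = Ideal.Quotient.mk (Ideal.span {α}) ⟨0, 1⟩ * (1 - x ^ 2)

/-- The iteration `x ↦ i (1 - x²) / (2 x)` in `ℤ[i]/(α)`, started at the residue of the
`x`-coordinate of the point `P`, is defined for `N` steps (in particular that residue is defined)
and ends at `c`. -/
def IterEndsAt (α : GaussianInt) (P : E30 QI) (N : ℕ) (c : ResidueRing α) : Prop :=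
  ∃ x : ℕ → ResidueRing α,
    (∃ (x₀ y₀ : QI) (h : 30 * y₀ ^ 2 = x₀ ^ 3 - x₀),
      P = E30.affine x₀ y₀ h ∧ ReducesTo α x₀ (x 0)) ∧
    (∀ j < N, IterStep α (x j) (x (j + 1))) ∧ x N = c

/-- The point `(5, 2)` of `E₃₀(ℚ(i))`. -/
def point52 : E30 QI := E30.affine 5 2 (by norm_num)

end

set_option linter.unusedSectionVars false

/-! Put `M = p 4ⁿ`, so that `S = M² + 1` is the norm of `α = M + i`, and let `φ = 1 + i`. The origin
`(0, 0)` is killed by `φ`, and `φ` acts on x-coordinates by `x ↦ i (1 - x²) / (2 x)`. Hence both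
tests say that `φ^(4n-1) Q` reduces to the origin. They are moved between `ℚ(i)` and residue fields
by the fact that reduction of points is additive (`TwistPoint.Red.add`).

From the test to primality (`prime_of_forall_hom`): if `S` is composite, its least prime factor `q`
is at most `M`, and `i ↦ -M` maps `ℤ[i]` to `𝔽_q`, killing `α`. The image of `Q` is killed by
`φ^(4n)` but not by `φ^(4n-1)`, so the curve has at least `16ⁿ` points over `𝔽_q`
(`two_pow_le_card_of_iterate`). It has at most `2 (q + 1) ≤ 2 (M + 1)` points
(`TwistPoint.card_le`), and this is less than `16ⁿ` because `p < 2ⁿ`.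

From primality to the test (`phi_iterate_eq_origin`): over an algebraic closure of `𝔽_S`, let `j` be
the image of `i`, so that `M + j = 0`. Then `M + i` acts as Frobenius followed by `i`
(`nsmul_add_cm_eq`). To see this, let `G = (X, s)` be a generic point over `k(X)`. The x-coordinate
of `(M + i) G` has degree `M² + 1 = S` by the parallelogram law, and its derivative has the factor
`M + j = 0`, so it is a fractional linear function of `X^S`. Since `4 ∣ M`, on points killed by 4
the action of `M + i` is that of `i`; three such points force the function `-X^S`. Specialising `X`
gives the claim for all points with `y ≠ 0`.

Now choose `P` with `φ P = (5, 2)`. The congruences on `p` make 30 a square and -24 a nonsquare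
modulo `S`, and it follows that Frobenius sends `P` to `P + (0, 0)`. Comparison with `(M + i) P`
gives `M P = (0, 0)`. As `φ⁴ = -4`, the point `φ^(4n-1) Q = φ^(4n) (p P)` is `± M P`, which is the
origin. -/

/-! ### Group law and complex multiplication on the twists `c y² = x³ - x`. -/

/-- The Weierstrass curve `Y² = X³ - c² X`, isomorphic to the twist `c y² = x³ - x` of `y² = x³ - x`
through `(x, y) ↦ (c x, c² y)`. -/
def twist {F : Type*} [Field F] (c : F) : WeierstrassCurve.Affine F := ⟨0, 0, 0, -c ^ 2, 0⟩

/-- The rational points of the projective closure of `c y² = x³ - x`. -/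
def TwistPoint {F : Type*} [Field F] (c : F) : Type _ := (twist c).Point

namespace TwistPoint

variable {F : Type*} [Field F] {c : F}

open Classical in
noncomputable instance : AddCommGroup (TwistPoint c) :=
  inferInstanceAs (AddCommGroup (twist c).Point)

theorem twist_nonsingular [NeZero c] [NeZero (2 : F)] {x y : F} (h : c * y ^ 2 = x ^ 3 - x) :
    (twist c).Nonsingular (c * x) (c ^ 2 * y) := by
  rw [← WeierstrassCurve.Affine.equation_iff_nonsingular_of_Δ_ne_zero]
  · rw [WeierstrassCurve.Affine.equation_iff]
    simp only [twist]
    linear_combination c ^ 3 * h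
  · have : (twist c).Δ = 2 ^ 6 * c ^ 6 := by
      simp only [WeierstrassCurve.Δ, WeierstrassCurve.b₂, WeierstrassCurve.b₄,
        WeierstrassCurve.b₆, WeierstrassCurve.b₈, twist]
      ring
    rw [this]
    exact mul_ne_zero (pow_ne_zero _ (NeZero.ne _)) (pow_ne_zero _ (NeZero.ne _))

variable [NeZero c] [NeZero (2 : F)]

/-- The affine point `(x, y)` of `c y² = x³ - x`. -/
def mk (x y : F) (h : c * y ^ 2 = x ^ 3 - x) : TwistPoint c :=
  WeierstrassCurve.Affine.Point.some (c * x) (c ^ 2 * y) (twist_nonsingular h)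

theorem mk_ne_zero {x y : F} (h : c * y ^ 2 = x ^ 3 - x) : mk x y h ≠ 0 :=
  WeierstrassCurve.Affine.Point.some_ne_zero _

theorem mk_inj {x y x' y' : F} {h : c * y ^ 2 = x ^ 3 - x} {h' : c * y' ^ 2 = x' ^ 3 - x'} :
    mk x y h = mk x' y' h' ↔ x = x' ∧ y = y' := by
  have hc : c ≠ 0 := NeZero.ne _
  change @Eq (twist c).Point (.some _ _ _) (.some _ _ _) ↔ _
  rw [WeierstrassCurve.Affine.Point.some.injEq, mul_right_inj' hc,
    mul_right_inj' (pow_ne_zero 2 hc)]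

theorem eq_zero_or_mk (P : TwistPoint c) : P = 0 ∨ ∃ x y h, P = mk x y h := by
  have hc : c ≠ 0 := NeZero.ne _
  rcases P with _ | ⟨X, Y, h⟩
  · exact Or.inl rfl
  · refine Or.inr ⟨X / c, Y / c ^ 2, ?_, ?_⟩
    · have := (WeierstrassCurve.Affine.equation_iff _ _).1 h.1
      simp only [twist] at this
      field_simp
      linear_combination this
    · change @Eq (twist c).Point (.some _ _ _) (.some _ _ _)
      rw [WeierstrassCurve.Affine.Point.some.injEq]
      constructor <;> field_simp

theorem exists_mk_of_ne_zero {P : TwistPoint c} (hP : P ≠ 0) : ∃ x y h, P = mk x y h :=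
  (eq_zero_or_mk P).resolve_left hP

theorem neg_mk {x y : F} (h : c * y ^ 2 = x ^ 3 - x) :
    -mk x y h = mk x (-y) (by rw [neg_sq, h]) := by
  change @Eq (twist c).Point 
    (WeierstrassCurve.Affine.Point.neg (.some _ _ (twist_nonsingular h))) (.some _ _ _)
  rw [WeierstrassCurve.Affine.Point.neg, WeierstrassCurve.Affine.Point.some.injEq]
  simp only [WeierstrassCurve.Affine.negY, twist, true_and]
  ring

theorem mk_add_mk_of_neg {x y₁ y₂ : F} (h₁ : c * y₁ ^ 2 = x ^ 3 - x) (h₂ : c * y₂ ^ 2 = x ^ 3 - x)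
    (h : y₁ = -y₂) : mk x y₁ h₁ + mk x y₂ h₂ = 0 := by
  have : mk x y₁ h₁ = -mk x y₂ h₂ := by rw [neg_mk, mk_inj]; exact ⟨rfl, h⟩
  rw [this, neg_add_cancel]

omit [NeZero c] [NeZero (2 : F)] in
theorem chord_mem {x₁ y₁ x₂ y₂ l : F} (h₁ : c * y₁ ^ 2 = x₁ ^ 3 - x₁)
    (hl : l * (x₁ - x₂) = y₁ - y₂) (hl' : c * l * (y₁ + y₂) = x₁ ^ 2 + x₁ * x₂ + x₂ ^ 2 - 1) :
    c * (l * (x₁ - (c * l ^ 2 - x₁ - x₂)) - y₁) ^ 2 =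
      (c * l ^ 2 - x₁ - x₂) ^ 3 - (c * l ^ 2 - x₁ - x₂) := by
  linear_combination h₁ + (c * l ^ 2 - 2 * x₁ - x₂) * hl' +
    (-c * l * (c * l ^ 2 - 2 * x₁ - x₂)) * hl

/-- Addition through any line that is a chord (first equation) and, if the points are equal, a
tangent (second equation). -/
theorem mk_add_mk {x₁ y₁ x₂ y₂ : F} (h₁ : c * y₁ ^ 2 = x₁ ^ 3 - x₁)
    (h₂ : c * y₂ ^ 2 = x₂ ^ 3 - x₂) (h : ¬(x₁ = x₂ ∧ y₁ = -y₂)) {l : F}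
    (hl : l * (x₁ - x₂) = y₁ - y₂) (hl' : c * l * (y₁ + y₂) = x₁ ^ 2 + x₁ * x₂ + x₂ ^ 2 - 1) :
    mk x₁ y₁ h₁ + mk x₂ y₂ h₂ =
      mk (c * l ^ 2 - x₁ - x₂) (l * (x₁ - (c * l ^ 2 - x₁ - x₂)) - y₁)
        (chord_mem h₁ hl hl') := by
  classical
  have hc : c ≠ 0 := NeZero.ne _
  have h2 : (2 : F) ≠ 0 := NeZero.ne _
  have hn : (twist c).negY (c * x₂) (c ^ 2 * y₂) = c ^ 2 * -y₂ := by
    simp [twist, WeierstrassCurve.Affine.negY]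
  have hs : (twist c).slope (c * x₁) (c * x₂) (c ^ 2 * y₁) (c ^ 2 * y₂) = c * l := by
    by_cases hx : x₁ = x₂
    · subst hx
      have hy : y₁ = y₂ := by linear_combination -hl
      subst hy
      have hy0 : y₁ ≠ 0 := by
        rintro rfl
        exact h ⟨rfl, by simp⟩
      rw [WeierstrassCurve.Affine.slope_of_Y_ne rfl]
      · simp only [WeierstrassCurve.Affine.negY, twist]
        rw [div_eq_iff]
        · linear_combination -c ^ 2 * hl'
        · rw [show c ^ 2 * y₁ - (-(c ^ 2 * y₁) - 0 * (c * x₁) - 0) = 2 * (c * c) * y₁ by ring]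
          exact mul_ne_zero (mul_ne_zero h2 (mul_ne_zero hc hc)) hy0
      · rw [hn]
        intro h'
        exact h ⟨rfl, mul_left_cancel₀ (pow_ne_zero 2 hc) h'⟩
    · rw [WeierstrassCurve.Affine.slope_of_X_ne (fun h' => hx (mul_left_cancel₀ hc h')),
        div_eq_iff (by rw [← mul_sub]; exact mul_ne_zero hc (sub_ne_zero.2 hx))]
      linear_combination -c ^ 2 * hl
  change @Eq (twist c).Point (WeierstrassCurve.Affine.Point.add
    (.some _ _ (twist_nonsingular h₁)) (.some _ _ (twist_nonsingular h₂))) (.some _ _ _)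
  rw [← WeierstrassCurve.Affine.Point.add_def]
  rw [WeierstrassCurve.Affine.Point.add_some
    (fun h' => h ⟨mul_left_cancel₀ hc h'.1, mul_left_cancel₀ (pow_ne_zero 2 hc) (h'.2.trans hn)⟩)]
  rw [WeierstrassCurve.Affine.Point.some.injEq, hs]
  simp only [WeierstrassCurve.Affine.addX,
    WeierstrassCurve.Affine.addY, WeierstrassCurve.Affine.negAddY,
    WeierstrassCurve.Affine.negY, twist]
  constructor <;> ring

omit [NeZero (2 : F)] in
/-- Two points that are not opposite lie on a chord or tangent with finite slope. -/
theorem exists_slope {x₁ y₁ x₂ y₂ : F} (h₁ : c * y₁ ^ 2 = x₁ ^ 3 - x₁)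
    (h₂ : c * y₂ ^ 2 = x₂ ^ 3 - x₂) (h : ¬(x₁ = x₂ ∧ y₁ = -y₂)) :
    ∃ l, l * (x₁ - x₂) = y₁ - y₂ ∧ c * l * (y₁ + y₂) = x₁ ^ 2 + x₁ * x₂ + x₂ ^ 2 - 1 := by
  have hc : c ≠ 0 := NeZero.ne _
  by_cases hx : x₁ = x₂
  · subst hx
    have hy : y₁ + y₂ ≠ 0 := fun h0 => h ⟨rfl, by linear_combination h0⟩
    have hd : y₁ = y₂ := by
      have h0 : c * ((y₁ - y₂) * (y₁ + y₂)) = 0 := by linear_combination h₁ - h₂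
      exact sub_eq_zero.1 (((mul_eq_zero.1 h0).resolve_left hc |> mul_eq_zero.1).resolve_right hy)
    refine ⟨(x₁ ^ 2 + x₁ * x₁ + x₁ ^ 2 - 1) / (c * (y₁ + y₂)), ?_, ?_⟩
    · rw [hd]; ring
    · field_simp
  · have hd : x₁ - x₂ ≠ 0 := sub_ne_zero.2 hx
    refine ⟨(y₁ - y₂) / (x₁ - x₂), div_mul_cancel₀ _ hd, ?_⟩
    field_simp
    linear_combination h₁ - h₂

theorem mk_add_mk_of_ne {x₁ y₁ x₂ y₂ : F} (h₁ : c * y₁ ^ 2 = x₁ ^ 3 - x₁)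
    (h₂ : c * y₂ ^ 2 = x₂ ^ 3 - x₂) (h : x₁ ≠ x₂) {l : F} (hl : l * (x₁ - x₂) = y₁ - y₂) :
    ∃ h₃, mk x₁ y₁ h₁ + mk x₂ y₂ h₂ =
      mk (c * l ^ 2 - x₁ - x₂) (l * (x₁ - (c * l ^ 2 - x₁ - x₂)) - y₁) h₃ := by
  have hl' : c * l * (y₁ + y₂) = x₁ ^ 2 + x₁ * x₂ + x₂ ^ 2 - 1 := by
    refine mul_right_cancel₀ (sub_ne_zero.2 h) ?_
    linear_combination c * (y₁ + y₂) * hl + h₁ - h₂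
  exact ⟨_, mk_add_mk h₁ h₂ (fun h' => h h'.1) hl hl'⟩

section CM

variable {j : F} (hj : j ^ 2 = -1)

/-- The automorphism `(x, y) ↦ (-x, j y)`, for a square root `j` of `-1`, as a map. -/
noncomputable def cmFun (c : F) (j : F) (hj : j ^ 2 = -1) : TwistPoint c → TwistPoint c
  | .zero => 0
  | .some X Y h => WeierstrassCurve.Affine.Point.some (-X) (j * Y) (by
      have hj0 : j ≠ 0 := by
        rintro rfl
        norm_num at hj
      rw [WeierstrassCurve.Affine.nonsingular_iff, WeierstrassCurve.Affine.equation_iff] at h ⊢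
      simp only [twist, zero_mul, add_zero, sub_zero, mul_zero] at h ⊢
      refine ⟨by linear_combination Y ^ 2 * hj - h.1, ?_⟩
      rcases h.2 with h' | h'
      · left
        intro h0
        exact h' (by linear_combination h0)
      · right
        intro h0
        exact h' (mul_left_cancel₀ hj0 (by linear_combination h0)))

theorem cmFun_mk {x y : F} (h : c * y ^ 2 = x ^ 3 - x) :
    cmFun c j hj (mk x y h) =
      mk (-x) (j * y) (by linear_combination c * y ^ 2 * hj - h) := by
  change @Eq (twist c).Point (.some (-(c * x)) (j * (c ^ 2 * y)) _) (.some _ _ _)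
  rw [WeierstrassCurve.Affine.Point.some.injEq]
  constructor <;> ring

include hj in
theorem cmFun_add (P Q : TwistPoint c) :
    cmFun c j hj (P + Q) = cmFun c j hj P + cmFun c j hj Q := by
  have hj0 : j ≠ 0 := by
    rintro rfl
    norm_num at hj
  have h0 : cmFun c j hj 0 = 0 := rfl
  rcases eq_zero_or_mk P with rfl | ⟨x₁, y₁, h₁, rfl⟩
  · rw [h0, zero_add, zero_add]
  rcases eq_zero_or_mk Q with rfl | ⟨x₂, y₂, h₂, rfl⟩
  · rw [h0, add_zero, add_zero]
  by_cases h : x₁ = x₂ ∧ y₁ = -y₂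
  · obtain ⟨rfl, hy⟩ := h
    rw [mk_add_mk_of_neg h₁ h₂ hy, h0, cmFun_mk, cmFun_mk, mk_add_mk_of_neg]
    rw [hy, mul_neg]
  · obtain ⟨l, hl, hl'⟩ := exists_slope h₁ h₂ h
    have h' : ¬(-x₁ = -x₂ ∧ j * y₁ = -(j * y₂)) := fun h' =>
      h ⟨neg_injective h'.1, mul_left_cancel₀ hj0 (by rw [h'.2, mul_neg])⟩
    rw [mk_add_mk h₁ h₂ h hl hl', cmFun_mk, cmFun_mk, cmFun_mk, mk_add_mk (l := -j * l) _ _ h',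
      mk_inj]
    · constructor
      · linear_combination -c * l ^ 2 * hj
      · linear_combination (-c) * l ^ 3 * j * hj
    · linear_combination j * hl
    · linear_combination -hj * c * l * (y₁ + y₂) + hl'

/-- The automorphism `(x, y) ↦ (-x, j y)`, for a square root `j` of `-1`. -/
noncomputable def cm (c : F) [NeZero c] (j : F) (hj : j ^ 2 = -1) :
    TwistPoint c →+ TwistPoint c where
  toFun := cmFun c j hj
  map_zero' := rfl
  map_add' := cmFun_add hj

theorem cm_mk {x y : F} (h : c * y ^ 2 = x ^ 3 - x) :
    cm c j hj (mk x y h) = mk (-x) (j * y) (by linear_combination c * y ^ 2 * hj - h) :=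
  cmFun_mk hj h

theorem cm_cm (P : TwistPoint c) : cm c j hj (cm c j hj P) = -P := by
  rcases eq_zero_or_mk P with rfl | ⟨x, y, h, rfl⟩
  · simp
  · rw [cm_mk, cm_mk, neg_mk, mk_inj]
    exact ⟨by ring, by linear_combination y * hj⟩

/-- Multiplication by `1 + j`. -/
noncomputable def phi (c : F) [NeZero c] (j : F) (hj : j ^ 2 = -1) :
    TwistPoint c →+ TwistPoint c := AddMonoidHom.id _ + cm c j hj

theorem phi_apply (P : TwistPoint c) : phi c j hj P = P + cm c j hj P := rfl

theorem phi_phi (P : TwistPoint c) : phi c j hj (phi c j hj P) = 2 • cm c j hj P := by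
  simp only [phi_apply, map_add, cm_cm]
  abel

/-- The origin, the nonzero point killed by `1 + j`. -/
def origin (c : F) [NeZero c] : TwistPoint c := mk 0 0 (by simp)

theorem cm_origin : cm c j hj (origin c) = origin c := by
  unfold origin
  rw [cm_mk, mk_inj]
  simp

theorem two_nsmul_origin : 2 • origin c = 0 := by
  rw [two_nsmul]
  exact mk_add_mk_of_neg _ _ (by simp)

theorem phi_origin : phi c j hj (origin c) = 0 := by
  rw [phi_apply, cm_origin, ← two_nsmul, two_nsmul_origin]

theorem origin_ne_zero : origin c ≠ 0 := mk_ne_zero _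

theorem mk_zero_left {y : F} (h : c * y ^ 2 = 0 ^ 3 - 0) : mk 0 y h = origin c := by
  unfold origin
  rw [mk_inj]
  refine ⟨rfl, ?_⟩
  have : c * y ^ 2 = 0 := by rw [h]; ring
  simpa [NeZero.ne c] using this

/-- The chord through `(x, y)` and `(-x, j y)` has slope `(1 - j) y / (2 x)`. The resulting
x-coordinate is the step of the iteration in the second test. -/
theorem phi_mk {x y : F} (h : c * y ^ 2 = x ^ 3 - x) (hx : x ≠ 0) :
    ∃ h', phi c j hj (mk x y h) = mk (j * (1 - x ^ 2) / (2 * x))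
      ((1 - j) * y / (2 * x) * (x - j * (1 - x ^ 2) / (2 * x)) - y) h' := by
  have h2 : (2 : F) ≠ 0 := NeZero.ne _
  rw [phi_apply, cm_mk]
  obtain ⟨h', he⟩ := mk_add_mk_of_ne h
    (show c * (j * y) ^ 2 = (-x) ^ 3 - -x by linear_combination c * y ^ 2 * hj - h)
    (fun h0 => hx ((mul_eq_zero.1 (show 2 * x = 0 by linear_combination h0)).resolve_left h2))
    (l := (1 - j) * y / (2 * x)) (by field_simp; ring)
  have hX : c * ((1 - j) * y / (2 * x)) ^ 2 - x - -x = j * (1 - x ^ 2) / (2 * x) := by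
    field_simp
    linear_combination (c * y ^ 2) * hj - 2 * j * h
  rw [he]
  have h'' := h'
  rw [hX] at h''
  refine ⟨h'', ?_⟩
  rw [mk_inj, hX]
  exact ⟨rfl, rfl⟩

end CM

/-- Over each `x` lie at most two points, opposite to each other. This crude bound suffices; Hasse's
theorem is not needed. -/
theorem card_le [Finite F] :
    Finite (TwistPoint c) ∧ Nat.card (TwistPoint c) ≤ 2 * (Nat.card F + 1) := by
  classical
  have := Fintype.ofFinite F
  have hfin : Finite (TwistPoint c) := by
    refine Finite.of_surjective (α := Option {z : F × F // c * z.2 ^ 2 = z.1 ^ 3 - z.1})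
      (fun o => o.elim 0 fun z => mk z.1.1 z.1.2 z.2) fun P => ?_
    rcases eq_zero_or_mk P with rfl | ⟨x, y, h, rfl⟩
    · exact ⟨none, rfl⟩
    · exact ⟨some ⟨(x, y), h⟩, rfl⟩
  refine ⟨hfin, ?_⟩
  have := Fintype.ofFinite (TwistPoint c)
  let e : Option F × Bool → TwistPoint c := fun z => z.1.elim 0 fun x =>
    if hx : ∃ y, c * y ^ 2 = x ^ 3 - x then
      (if z.2 then mk x hx.choose hx.choose_spec else -mk x hx.choose hx.choose_spec) else 0
  have he : Function.Surjective e := by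
    intro P
    rcases eq_zero_or_mk P with rfl | ⟨x, y, h, rfl⟩
    · exact ⟨(none, true), rfl⟩
    · have hx : ∃ y, c * y ^ 2 = x ^ 3 - x := ⟨y, h⟩
      have h0 : c * ((y - hx.choose) * (y + hx.choose)) = 0 := by
        linear_combination h - hx.choose_spec
      rcases mul_eq_zero.1 ((mul_eq_zero.1 h0).resolve_left (NeZero.ne _)) with h' | h'
      · refine ⟨(some x, true), ?_⟩
        simp only [e, Option.elim, dif_pos hx, if_true, mk_inj]
        exact ⟨trivial, (sub_eq_zero.1 h').symm⟩
      · refine ⟨(some x, false), ?_⟩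
        simp only [e, Option.elim, dif_pos hx, neg_mk, mk_inj, Bool.false_eq_true, if_false]
        exact ⟨trivial, (eq_neg_of_add_eq_zero_left h').symm⟩
  calc Nat.card (TwistPoint c) ≤ Nat.card (Option F × Bool) :=
        Nat.card_le_card_of_surjective e he
    _ = 2 * (Nat.card F + 1) := by
        rw [Nat.card_prod, Finite.card_option]; simp [mul_comm]

end TwistPoint

/-! ### Reduction of elements of a fraction field. -/

/-- `x` in the fraction field of `A` is integral at the kernel of `f : A → k`, with value `r`. -/
def RedTo {A K k : Type*} [CommRing A] [Field K] [Algebra A K] [Field k] (f : A →+* k) (x : K)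
    (r : k) : Prop :=
  ∃ a d : A, f d ≠ 0 ∧ algebraMap A K d * x = algebraMap A K a ∧ f d * r = f a

namespace RedTo

variable {A K k : Type*} [CommRing A] [Field K] [Algebra A K] [Field k] {f : A →+* k}
  {x y : K} {r s : k}

theorem of_algebraMap (a : A) : RedTo f (algebraMap A K a) (f a) :=
  ⟨a, 1, by simp, by simp, by simp⟩

theorem zero : RedTo f (0 : K) 0 := by simpa using of_algebraMap (K := K) (f := f) 0

theorem one : RedTo f (1 : K) 1 := by simpa using of_algebraMap (K := K) (f := f) 1

theorem natCast (n : ℕ) : RedTo f (n : K) (n : k) := by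
  simpa using of_algebraMap (K := K) (f := f) (n : A)

theorem ofNat (n : ℕ) [n.AtLeastTwo] : RedTo f (OfNat.ofNat n : K) (OfNat.ofNat n) := by
  simpa only [Nat.cast_ofNat] using natCast (K := K) (f := f) (OfNat.ofNat n)

theorem add (hx : RedTo f x r) (hy : RedTo f y s) : RedTo f (x + y) (r + s) := by
  obtain ⟨a, d, hd, h, h'⟩ := hx
  obtain ⟨b, e, he, g, g'⟩ := hy
  refine ⟨a * e + b * d, d * e, ?_, ?_, ?_⟩
  · rw [map_mul]; exact mul_ne_zero hd he
  · simp only [map_mul, map_add]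
    linear_combination algebraMap A K e * h + algebraMap A K d * g
  · simp only [map_mul, map_add]
    linear_combination f e * h' + f d * g'

theorem mul (hx : RedTo f x r) (hy : RedTo f y s) : RedTo f (x * y) (r * s) := by
  obtain ⟨a, d, hd, h, h'⟩ := hx
  obtain ⟨b, e, he, g, g'⟩ := hy
  refine ⟨a * b, d * e, ?_, ?_, ?_⟩
  · rw [map_mul]; exact mul_ne_zero hd he
  · simp only [map_mul]
    linear_combination algebraMap A K e * y * h + algebraMap A K a * g
  · simp only [map_mul]
    linear_combination f e * s * h' + f a * g'

theorem neg (hx : RedTo f x r) : RedTo f (-x) (-r) := by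
  obtain ⟨a, d, hd, h, h'⟩ := hx
  refine ⟨-a, d, hd, ?_, ?_⟩
  · rw [map_neg]; linear_combination -h
  · rw [map_neg]; linear_combination -h'

theorem sub (hx : RedTo f x r) (hy : RedTo f y s) : RedTo f (x - y) (r - s) := by
  rw [sub_eq_add_neg, sub_eq_add_neg]; exact hx.add hy.neg

theorem pow (hx : RedTo f x r) (n : ℕ) : RedTo f (x ^ n) (r ^ n) := by
  induction n with
  | zero => simpa using one
  | succ n ih => rw [pow_succ, pow_succ]; exact ih.mul hx

variable [IsDomain A] [IsFractionRing A K]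

theorem unique (hx : RedTo f x r) (hy : RedTo f x s) : r = s := by
  obtain ⟨a, d, hd, h, h'⟩ := hx
  obtain ⟨b, e, he, g, g'⟩ := hy
  have hab : a * e = b * d := by
    apply IsFractionRing.injective A K
    rw [map_mul, map_mul]
    linear_combination algebraMap A K d * g - algebraMap A K e * h
  have hf : f a * f e = f b * f d := by rw [← map_mul, hab, map_mul]
  have : f d * f e * (r - s) = 0 := by linear_combination f e * h' - f d * g' + hf
  exact sub_eq_zero.1 ((mul_eq_zero.1 this).resolve_left (mul_ne_zero hd he))

theorem ne_zero (hx : RedTo f x r) (hr : r ≠ 0) : x ≠ 0 := by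
  rintro rfl
  exact hr (hx.unique zero)

theorem inv (hx : RedTo f x r) (hr : r ≠ 0) : RedTo f x⁻¹ r⁻¹ := by
  have hx0 := hx.ne_zero hr
  obtain ⟨a, d, hd, h, h'⟩ := hx
  refine ⟨d, a, ?_, ?_, ?_⟩
  · rw [← h']; exact mul_ne_zero hd hr
  · rw [← h, mul_assoc, mul_inv_cancel₀ hx0, mul_one]
  · rw [← h', mul_assoc, mul_inv_cancel₀ hr, mul_one]

theorem div (hx : RedTo f x r) (hy : RedTo f y s) (hs : s ≠ 0) : RedTo f (x / y) (r / s) := by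
  rw [div_eq_mul_inv, div_eq_mul_inv]; exact hx.mul (hy.inv hs)

/-- In lowest terms, Bézout forbids numerator and denominator from both lying in the kernel of `f`;
so either `x` or its inverse has a value. -/
theorem inv_of_not [IsPrincipalIdealRing A] (hx : ∀ r, ¬RedTo f x r) : RedTo f x⁻¹ 0 := by
  obtain ⟨a, d, had, rfl⟩ := IsFractionRing.exists_reduced_fraction (A := A) (K := K) x
  have hd0 : algebraMap A K d ≠ 0 := IsFractionRing.to_map_ne_zero_of_mem_nonZeroDivisors d.2
  obtain ⟨u, v, huv⟩ := had.isCoprime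
  have hspec := IsLocalization.mk'_spec' K a d
  by_cases hd : f d = 0
  · have ha : f a ≠ 0 := by
      intro ha
      have := congrArg f huv
      simp [ha, hd] at this
    have hx0 : IsLocalization.mk' K a d ≠ 0 := fun h0 => hx 0 (h0 ▸ zero)
    refine ⟨d, a, ha, ?_, by simp [hd]⟩
    rw [← hspec, mul_assoc, mul_inv_cancel₀ hx0, mul_one]
  · exact absurd ⟨a, d, hd, hspec, by field_simp⟩ (hx (f a / f d))

/-- Otherwise `x⁻¹` reduces to 0, and then so does `1 = (x⁻¹)² x²`. This provides the integrality of
y-coordinates and of slopes. -/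
theorem exists_of_sq [IsPrincipalIdealRing A] (hx : RedTo f (x ^ 2) r) : ∃ s, RedTo f x s := by
  by_contra! hn
  have hx0 : x ≠ 0 := fun h0 => hn 0 (h0 ▸ zero)
  have := (((inv_of_not hn).pow 2).mul hx).unique
    (by rw [← mul_pow, inv_mul_cancel₀ hx0, one_pow]; exact one)
  simp at this

end RedTo

/-! ### Reduction of points is a homomorphism. -/

namespace TwistPoint

variable {A K k : Type*} [CommRing A] [Field K] [Algebra A K] [Field k] {f : A →+* k}
  {c : K} {e : k} [NeZero c] [NeZero (2 : K)] [NeZero e] [NeZero (2 : k)]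

/-- The point `Q` is the reduction of the point `P`. -/
def Red (f : A →+* k) (P : TwistPoint c) (Q : TwistPoint e) : Prop :=
  (∃ x y h x' y' h', P = mk x y h ∧ Q = mk x' y' h' ∧ RedTo f x x' ∧ RedTo f y y') ∨
    (Q = 0 ∧ ∀ x y h, P = mk x y h → ∀ r, ¬RedTo f x r)

namespace Red

variable {P P₁ P₂ : TwistPoint c} {Q Q₁ Q₂ : TwistPoint e}

theorem mk {x y : K} {h : c * y ^ 2 = x ^ 3 - x} {x' y' : k} {h' : e * y' ^ 2 = x' ^ 3 - x'}
    (hx : RedTo f x x') (hy : RedTo f y y') : Red f (mk x y h) (mk x' y' h') :=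
  Or.inl ⟨x, y, h, x', y', h', rfl, rfl, hx, hy⟩

theorem zero : Red f (0 : TwistPoint c) (0 : TwistPoint e) :=
  Or.inr ⟨rfl, fun _ _ h h0 => absurd h0.symm (mk_ne_zero h)⟩

theorem neg (h : Red f P Q) : Red f (-P) (-Q) := by
  rcases h with ⟨x, y, h, x', y', h', rfl, rfl, hx, hy⟩ | ⟨rfl, hP⟩
  · rw [neg_mk, neg_mk]
    exact mk hx hy.neg
  · refine Or.inr ⟨neg_zero, fun x y h h0 => hP x (-y) (by rw [neg_sq, h]) ?_⟩
    rw [← neg_mk h, ← h0, neg_neg]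

theorem cm {j : K} (hj : j ^ 2 = -1) {i : k} (hi : i ^ 2 = -1) (hji : RedTo f j i)
    (h : Red f P Q) : Red f (cm c j hj P) (cm e i hi Q) := by
  rcases h with ⟨x, y, h, x', y', h', rfl, rfl, hx, hy⟩ | ⟨rfl, hP⟩
  · rw [cm_mk, cm_mk]
    exact mk hx.neg (hji.mul hy)
  · refine Or.inr ⟨map_zero _, fun x y h h0 r hr => ?_⟩
    rcases eq_zero_or_mk P with rfl | ⟨x₁, y₁, h₁, rfl⟩
    · rw [map_zero] at h0
      exact mk_ne_zero h h0.symm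
    · rw [cm_mk, mk_inj] at h0
      refine hP x₁ y₁ h₁ rfl (-r) ?_
      rw [← neg_neg x₁, h0.1]
      exact hr.neg

variable [IsDomain A] [IsFractionRing A K]

theorem exists_of_mk {x y : K} (h : c * y ^ 2 = x ^ 3 - x) {x' y' : k} (hc : RedTo f c e)
    (hx : RedTo f x x') (hy : RedTo f y y') : ∃ h', Red f (TwistPoint.mk x y h)
      (TwistPoint.mk (c := e) x' y' h') := by
  refine ⟨?_, mk hx hy⟩
  refine RedTo.unique (hc.mul (hy.pow 2)) ?_
  rw [h]
  exact (hx.pow 3).sub hx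

theorem of_eq_zero (h : Red f P Q) (hQ : Q = 0) {x y h₁} (hP : P = TwistPoint.mk x y h₁) (r : k) :
    ¬RedTo f x r := by
  rcases h with ⟨x, y, h, x', y', h', rfl, rfl, hx, hy⟩ | ⟨rfl, hP'⟩
  · exact absurd hQ (mk_ne_zero h')
  · exact hP' _ _ _ hP r

theorem of_eq_mk (h : Red f P Q) {x' y' h'} (hQ : Q = TwistPoint.mk x' y' h') :
    ∃ x y h, P = TwistPoint.mk x y h ∧ RedTo f x x' ∧ RedTo f y y' := by
  rcases h with ⟨x, y, h, x₁, y₁, h₁, rfl, rfl, hx, hy⟩ | ⟨rfl, hP'⟩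
  · obtain ⟨rfl, rfl⟩ := mk_inj.1 hQ
    exact ⟨x, y, h, rfl, hx, hy⟩
  · exact absurd hQ.symm (mk_ne_zero h')

theorem unique (h₁ : Red f P Q₁) (h₂ : Red f P Q₂) : Q₁ = Q₂ := by
  rcases eq_zero_or_mk Q₁ with rfl | ⟨x, y, h, rfl⟩
  · rcases eq_zero_or_mk Q₂ with rfl | ⟨x₂, y₂, h', rfl⟩
    · rfl
    · obtain ⟨x, y, h, rfl, hx, -⟩ := h₂.of_eq_mk rfl
      exact absurd hx (h₁.of_eq_zero rfl rfl _)
  · obtain ⟨x₁, y₁, h', rfl, hx, hy⟩ := h₁.of_eq_mk rfl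
    rcases eq_zero_or_mk Q₂ with rfl | ⟨x₂, y₂, h', rfl⟩
    · exact absurd hx (h₂.of_eq_zero rfl rfl _)
    · obtain ⟨x₃, y₃, h'', he, hx', hy'⟩ := h₂.of_eq_mk rfl
      obtain ⟨rfl, rfl⟩ := mk_inj.1 he
      rw [mk_inj]
      exact ⟨hx.unique hx', hy.unique hy'⟩

variable [IsPrincipalIdealRing A]

theorem exists_of_left {x y : K} (h : c * y ^ 2 = x ^ 3 - x) {x' : k} (hc : RedTo f c e)
    (hx : RedTo f x x') :
    ∃ y' h', RedTo f y y' ∧ Red f (TwistPoint.mk x y h) (TwistPoint.mk (c := e) x' y' h') := by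
  have hc0 : c ≠ 0 := NeZero.ne _
  have hy2 : RedTo f (y ^ 2) ((x' ^ 3 - x') / e) := by
    rw [show y ^ 2 = (x ^ 3 - x) / c by rw [← h]; field_simp]
    exact ((hx.pow 3).sub hx).div hc (NeZero.ne _)
  obtain ⟨y', hy⟩ := hy2.exists_of_sq
  obtain ⟨h', hr⟩ := exists_of_mk h hc hx hy
  exact ⟨y', h', hy, hr⟩

theorem exists_red (hc : RedTo f c e) (P : TwistPoint c) : ∃ Q : TwistPoint e, Red f P Q := by
  rcases eq_zero_or_mk P with rfl | ⟨x, y, h, rfl⟩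
  · exact ⟨0, zero⟩
  by_cases hx : ∃ r, RedTo f x r
  · obtain ⟨x', hx⟩ := hx
    obtain ⟨y', h', -, hr⟩ := exists_of_left h hc hx
    exact ⟨_, hr⟩
  · push Not at hx
    refine ⟨0, Or.inr ⟨rfl, fun x₁ y₁ h₁ h0 r => ?_⟩⟩
    rw [← (mk_inj.1 h0).1]
    exact hx r

/-- The slope is integral: one of its two expressions, chord or tangent, has a denominator that
survives reduction. The addition formulas then reduce term by term. -/
theorem add_of_ne_neg (hc : RedTo f c e) (h₁ : Red f P₁ Q₁) (h₂ : Red f P₂ Q₂) (hQ₁ : Q₁ ≠ 0)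
    (hQ₂ : Q₂ ≠ 0) (hQ : Q₁ + Q₂ ≠ 0) : Red f (P₁ + P₂) (Q₁ + Q₂) := by
  obtain ⟨x₁', y₁', g₁, rfl⟩ := exists_mk_of_ne_zero hQ₁
  obtain ⟨x₂', y₂', g₂, rfl⟩ := exists_mk_of_ne_zero hQ₂
  obtain ⟨x₁, y₁, e₁, rfl, hx₁, hy₁⟩ := h₁.of_eq_mk rfl
  obtain ⟨x₂, y₂, e₂, rfl, hx₂, hy₂⟩ := h₂.of_eq_mk rfl
  have hne' : ¬(x₁' = x₂' ∧ y₁' = -y₂') := by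
    rintro ⟨rfl, h⟩
    exact hQ (mk_add_mk_of_neg _ _ h)
  have hne : ¬(x₁ = x₂ ∧ y₁ = -y₂) := by
    rintro ⟨rfl, rfl⟩
    exact hne' ⟨hx₁.unique hx₂, hy₁.unique hy₂.neg⟩
  obtain ⟨l, hl, hl'⟩ := exists_slope e₁ e₂ hne
  have hlr : ∃ l', RedTo f l l' := by
    by_cases hx : x₁' = x₂'
    · subst hx
      have hy : y₁' + y₂' ≠ 0 := fun h0 => hne' ⟨rfl, by linear_combination h0⟩
      have hcy := mul_ne_zero (NeZero.ne e) hy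
      have := ((((hx₁.pow 2).add (hx₁.mul hx₂)).add (hx₂.pow 2)).sub RedTo.one).div
        (hc.mul (hy₁.add hy₂)) hcy
      rw [← hl', show c * l * (y₁ + y₂) = l * (c * (y₁ + y₂)) by ring, mul_div_cancel_right₀ _
        ((hc.mul (hy₁.add hy₂)).ne_zero hcy)] at this
      exact ⟨_, this⟩
    · have hd : x₁' - x₂' ≠ 0 := sub_ne_zero.2 hx
      have := (hy₁.sub hy₂).div (hx₁.sub hx₂) hd
      rw [← hl, mul_div_cancel_right₀ _ ((hx₁.sub hx₂).ne_zero hd)] at this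
      exact ⟨_, this⟩
  obtain ⟨l', hlr⟩ := hlr
  have gl : l' * (x₁' - x₂') = y₁' - y₂' := by
    refine (hlr.mul (hx₁.sub hx₂)).unique ?_
    rw [hl]
    exact hy₁.sub hy₂
  have gl' : e * l' * (y₁' + y₂') = x₁' ^ 2 + x₁' * x₂' + x₂' ^ 2 - 1 := by
    refine ((hc.mul hlr).mul (hy₁.add hy₂)).unique ?_
    rw [hl']
    exact (((hx₁.pow 2).add (hx₁.mul hx₂)).add (hx₂.pow 2)).sub RedTo.one
  rw [mk_add_mk e₁ e₂ hne hl hl', mk_add_mk g₁ g₂ hne' gl gl']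
  have hx₃ := ((hc.mul (hlr.pow 2)).sub hx₁).sub hx₂
  exact mk hx₃ ((hlr.mul (hx₁.sub hx₃)).sub hy₁)

/-- If the sum had an integral x-coordinate, the slope would be integral, and the chord and tangent
equations would reduce to `y' = 0` and `3 x'² = 1`. The reduced curve would then be singular at this
point. -/
theorem add_of_eq_neg (hc : RedTo f c e) (h₁ : Red f P₁ Q₁) (h₂ : Red f P₂ Q₂) (hQ₁ : Q₁ ≠ 0)
    (hQ : Q₁ + Q₂ = 0) : Red f (P₁ + P₂) 0 (c := c) (e := e) := by
  obtain rfl : Q₂ = -Q₁ := (neg_eq_of_add_eq_zero_right hQ).symm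
  obtain ⟨x', y', g, rfl⟩ := exists_mk_of_ne_zero hQ₁
  rw [neg_mk] at h₂
  obtain ⟨x₁, y₁, e₁, rfl, hx₁, hy₁⟩ := h₁.of_eq_mk rfl
  obtain ⟨x₂, y₂, e₂, rfl, hx₂, hy₂⟩ := h₂.of_eq_mk rfl
  by_cases hne : x₁ = x₂ ∧ y₁ = -y₂
  · obtain ⟨rfl, hy⟩ := hne
    rw [mk_add_mk_of_neg _ _ hy]
    exact zero
  obtain ⟨l, hl, hl'⟩ := exists_slope e₁ e₂ hne
  rw [mk_add_mk e₁ e₂ hne hl hl']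
  refine Or.inr ⟨rfl, fun x₃ y₃ h₃ h0 r hr => ?_⟩
  rw [← (mk_inj.1 h0).1] at hr
  have hc0 : c ≠ 0 := NeZero.ne _
  have h2 : (2 : k) ≠ 0 := NeZero.ne _
  have hl2 : RedTo f (l ^ 2) ((r + x' + x') / e) := by
    have := ((hr.add hx₁).add hx₂).div hc (NeZero.ne _)
    rwa [show (c * l ^ 2 - x₁ - x₂ + x₁ + x₂) / c = l ^ 2 by field_simp; ring] at this
  obtain ⟨l', hlr⟩ := hl2.exists_of_sq
  have gl : l' * (x' - x') = y' - -y' := by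
    refine (hlr.mul (hx₁.sub hx₂)).unique ?_
    rw [hl]
    exact hy₁.sub hy₂
  have gl' : e * l' * (y' + -y') = x' ^ 2 + x' * x' + x' ^ 2 - 1 := by
    refine ((hc.mul hlr).mul (hy₁.add hy₂)).unique ?_
    rw [hl']
    exact (((hx₁.pow 2).add (hx₁.mul hx₂)).add (hx₂.pow 2)).sub RedTo.one
  have hy0 : y' = 0 := by
    refine (mul_eq_zero.1 (?_ : 2 * y' = 0)).resolve_left h2
    linear_combination -gl
  subst hy0
  apply h2
  linear_combination (2 - 3 * x' ^ 2) * gl' + 9 * x' * g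

theorem add_of_eq_zero_left (hc : RedTo f c e) (h₁ : Red f P₁ 0 (c := c) (e := e))
    (h₂ : Red f P₂ Q₂) (hQ₂ : Q₂ ≠ 0) : Red f (P₁ + P₂) Q₂ := by
  obtain ⟨x₂', y₂', g₂, rfl⟩ := exists_mk_of_ne_zero hQ₂
  obtain ⟨x₂, y₂, e₂, rfl, hx₂, hy₂⟩ := h₂.of_eq_mk rfl
  rcases eq_zero_or_mk P₁ with rfl | ⟨x₁, y₁, e₁, rfl⟩
  · rwa [zero_add]
  have hx₁ := h₁.of_eq_zero rfl rfl
  obtain ⟨Q₃, h₃⟩ := exists_red hc (TwistPoint.mk x₁ y₁ e₁ + TwistPoint.mk x₂ y₂ e₂)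
  have hw := RedTo.inv_of_not hx₁
  have hx₁0 : x₁ ≠ 0 := fun h0 => hx₁ 0 (h0 ▸ RedTo.zero)
  have hc0 : c ≠ 0 := NeZero.ne _
  have hne : x₁ ≠ x₂ := fun h0 => hx₁ _ (h0 ▸ hx₂)
  have hd : x₁ - x₂ ≠ 0 := sub_ne_zero.2 hne
  have hQ₃ : Q₃ ≠ 0 := by
    intro hQ₃
    obtain ⟨e₃, he₃⟩ := mk_add_mk_of_ne e₁ e₂ hne (div_mul_cancel₀ (y₁ - y₂) hd)
    -- With `w = 1 / x₁`, the quantity `y₁ / x₁²` satisfies `c (y₁ / x₁²)² = w - w³`, so it is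
    -- integral. In these coordinates `x(P₁ + P₂)` has denominator `(1 - x₂ w)²`, which reduces to
    -- 1.
    obtain ⟨s, hs⟩ : ∃ s, RedTo f (y₁ * x₁⁻¹ ^ 2) s := by
      have : RedTo f ((y₁ * x₁⁻¹ ^ 2) ^ 2) ((0 - 0 ^ 3) / e) := by
        rw [show (y₁ * x₁⁻¹ ^ 2) ^ 2 = (x₁⁻¹ - x₁⁻¹ ^ 3) / c by
          field_simp
          linear_combination e₁]
        exact (hw.sub (hw.pow 3)).div hc (NeZero.ne _)
      exact this.exists_of_sq
    have hden : RedTo f ((1 - x₂ * x₁⁻¹) ^ 2) ((1 - x₂' * 0) ^ 2) :=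
      (RedTo.one.sub (hx₂.mul hw)).pow 2
    have hnum := ((RedTo.one.add (hx₂.mul hw)).mul (hx₂.sub hw)).sub
      ((((RedTo.ofNat 2).mul hc).mul hs).mul hy₂)
    have := hnum.div hden (by simp)
    have hd' : 1 - x₂ * x₁⁻¹ ≠ 0 := by
      rw [show 1 - x₂ * x₁⁻¹ = (x₁ - x₂) * x₁⁻¹ by field_simp]
      exact mul_ne_zero hd (inv_ne_zero hx₁0)
    refine h₃.of_eq_zero hQ₃ he₃ (((1 + x₂' * 0) * (x₂' - 0) - 2 * e * s * y₂') /
      (1 - x₂' * 0) ^ 2) ?_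
    convert this using 1
    rw [eq_div_iff (pow_ne_zero 2 hd')]
    field_simp
    linear_combination e₁ + e₂
  -- Subtracting `P₂` from the sum recovers `P₁`; if `Q₃` were not the reduction of `P₂`, then `P₁`
  -- would have a nonzero reduction.
  suffices Q₃ = TwistPoint.mk x₂' y₂' g₂ from this ▸ h₃
  by_contra hne₃
  have h₄ := h₃.add_of_ne_neg hc h₂.neg hQ₃ (neg_ne_zero.2 hQ₂)
    (by rwa [← sub_eq_add_neg, sub_ne_zero])
  rw [add_neg_cancel_right] at h₄
  exact hne₃ (by rw [← sub_eq_zero, sub_eq_add_neg]; exact h₄.unique h₁)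

theorem add (hc : RedTo f c e) (h₁ : Red f P₁ Q₁) (h₂ : Red f P₂ Q₂) :
    Red f (P₁ + P₂) (Q₁ + Q₂) := by
  by_cases hQ₁ : Q₁ = 0
  · subst hQ₁
    rw [zero_add]
    by_cases hQ₂ : Q₂ = 0
    · subst hQ₂
      obtain ⟨Q₃, h₃⟩ := exists_red hc (P₁ + P₂)
      by_cases hQ₃ : Q₃ = 0
      · exact hQ₃ ▸ h₃
      -- When both summands reduce to 0 but the sum does not, adding `-P₂` to the sum shows that
      -- `P₁` has the nonzero reduction `Q₃`.
      have h₂' := h₂.neg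
      rw [neg_zero] at h₂'
      have := h₂'.add_of_eq_zero_left hc h₃ hQ₃
      rw [neg_add_cancel_comm_assoc] at this
      exact absurd (this.unique h₁) hQ₃
    · exact add_of_eq_zero_left hc h₁ h₂ hQ₂
  · by_cases hQ₂ : Q₂ = 0
    · subst hQ₂
      rw [add_zero, add_comm]
      exact add_of_eq_zero_left hc h₂ h₁ hQ₁
    · by_cases hQ : Q₁ + Q₂ = 0
      · rw [hQ]
        exact add_of_eq_neg hc h₁ h₂ hQ₁ hQ
      · exact add_of_ne_neg hc h₁ h₂ hQ₁ hQ₂ hQ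

theorem nsmul (hc : RedTo f c e) (h : Red f P Q) (n : ℕ) : Red f (n • P) (n • Q) := by
  induction n with
  | zero => rw [zero_nsmul, zero_nsmul]; exact zero
  | succ n ih => rw [succ_nsmul, succ_nsmul]; exact ih.add hc h

theorem phi (hc : RedTo f c e) {j : K} (hj : j ^ 2 = -1) {i : k} (hi : i ^ 2 = -1)
    (hji : RedTo f j i) (h : Red f P Q) : Red f (phi c j hj P) (phi e i hi Q) :=
  h.add hc (h.cm hj hi hji)

end Red

end TwistPoint

/-! ### Heights of rational functions and the parallelogram law. -/

section RationalHeight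

open Polynomial

variable {k : Type*} [Field k]

/-- The degree of a rational function as a map of the projective line (zero for constants). -/
noncomputable def ratHeight (f : RatFunc k) : ℕ := max f.num.natDegree f.denom.natDegree

theorem ratHeight_eq {f : RatFunc k} {a b : k[X]} (hab : IsCoprime a b)
    (h : f * algebraMap _ _ b = algebraMap _ _ a) :
    ratHeight f = max a.natDegree b.natDegree := by
  have hd := f.denom_ne_zero
  have hco := f.isCoprime_num_denom
  have hd' : algebraMap k[X] (RatFunc k) f.denom ≠ 0 := by simpa using hd
  have he : f.num * b = a * f.denom := by
    apply IsFractionRing.injective k[X] (RatFunc k)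
    rw [map_mul, map_mul, ← h]
    have hfe : f * algebraMap k[X] (RatFunc k) f.denom = algebraMap _ _ f.num := by
      nth_rw 1 [← f.num_div_denom]; field_simp
    rw [← hfe]; ring
  have h1 : f.denom ∣ b := hco.symm.dvd_of_dvd_mul_left ⟨a, by rw [he, mul_comm]⟩
  have h2 : b ∣ f.denom := hab.symm.dvd_of_dvd_mul_left ⟨f.num, by rw [← he, mul_comm]⟩
  obtain ⟨u, hu⟩ := associated_of_dvd_dvd h1 h2
  have h3 : Associated f.num a := ⟨u, mul_right_cancel₀ hd (by
    rw [← he, ← hu]; ring)⟩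
  rw [ratHeight, natDegree_eq_of_degree_eq (degree_eq_degree_of_associated h3),
    natDegree_eq_of_degree_eq (degree_eq_degree_of_associated ⟨u, hu⟩)]

theorem ratHeight_neg (f : RatFunc k) : ratHeight (-f) = ratHeight f := by
  rw [ratHeight_eq (f := -f) (a := -f.num) (b := f.denom) f.isCoprime_num_denom.neg_left,
    natDegree_neg, ratHeight]
  have hd' : algebraMap k[X] (RatFunc k) f.denom ≠ 0 := by simpa using f.denom_ne_zero
  rw [map_neg]
  nth_rw 1 [← f.num_div_denom]
  field_simp

theorem ratHeight_X : ratHeight (RatFunc.X : RatFunc k) = 1 := by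
  rw [ratHeight_eq (a := X) (b := 1) isCoprime_one_right (by simp)]
  simp

theorem max_natDegree_mul_of_lt {a b c d : k[X]} (hd : d ≠ 0) (h : b.degree ≤ a.degree)
    (ha : a ≠ 0) (h' : c.degree < d.degree) :
    max (max (b * d).natDegree (a * d + c * b).natDegree) (a * c).natDegree =
      max a.natDegree b.natDegree + max c.natDegree d.natDegree := by
  have h1 := natDegree_le_natDegree h
  have h2 := natDegree_le_natDegree h'.le
  have h3 := natDegree_mul_le (p := b) (q := d)
  have h4 := natDegree_mul_le (p := a) (q := c)
  have h5 : (a * d + c * b).natDegree = a.natDegree + d.natDegree := by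
    by_cases hc : c = 0
    · rw [hc, zero_mul, add_zero, natDegree_mul ha hd]
    · have h6 := natDegree_lt_natDegree hc h'
      have h7 := natDegree_mul_le (p := c) (q := b)
      rw [natDegree_add_eq_left_of_natDegree_lt, natDegree_mul ha hd]
      rw [natDegree_mul ha hd]
      lia
  lia

/-- Up to sign, the three polynomials are the coefficients of `(b T - a) (d T - c)`; this is Gauss's
lemma at the place at infinity. -/
theorem max_natDegree_mul {a b c d : k[X]} (hb : b ≠ 0) (hd : d ≠ 0) :
    max (max (b * d).natDegree (a * d + c * b).natDegree) (a * c).natDegree =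
      max a.natDegree b.natDegree + max c.natDegree d.natDegree := by
  have ne_zero {p q : k[X]} (hq : q ≠ 0) (h : q.degree ≤ p.degree) : p ≠ 0 := by
    rintro rfl
    rw [degree_zero, le_bot_iff, degree_eq_bot] at h
    exact hq h
  rcases le_or_gt b.degree a.degree with h | h <;> rcases le_or_gt d.degree c.degree with h' | h'
  · have h1 := natDegree_le_natDegree h
    have h2 := natDegree_le_natDegree h'
    have h3 := natDegree_mul_le (p := b) (q := d)
    have h4 := natDegree_mul (ne_zero hb h) (ne_zero hd h')
    have h5 := natDegree_mul_le (p := a) (q := d)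
    have h6 := natDegree_mul_le (p := c) (q := b)
    have h7 := natDegree_add_le (a * d) (c * b)
    lia
  · exact max_natDegree_mul_of_lt hd h (ne_zero hb h) h'
  · rw [mul_comm b d, add_comm (a * d), mul_comm a c, add_comm (max _ _)]
    exact max_natDegree_mul_of_lt hb h' (ne_zero hd h') h
  · have h1 := natDegree_le_natDegree h.le
    have h2 := natDegree_le_natDegree h'.le
    have h3 := natDegree_mul hb hd
    have h4 := natDegree_mul_le (p := a) (q := c)
    have h5 := natDegree_mul_le (p := a) (q := d)
    have h6 := natDegree_mul_le (p := c) (q := b)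
    have h7 := natDegree_add_le (a * d) (c * b)
    lia

/-- Gauss's lemma at the finite places, for the same product of linear forms in `T`. -/
theorem span_symm_eq_top {a b c d : k[X]} (hab : IsCoprime a b) (hcd : IsCoprime c d) :
    Ideal.span {b * d, a * d + c * b, a * c} = ⊤ := by
  by_contra hne
  obtain ⟨m, hm, hle⟩ := Ideal.exists_le_maximal _ hne
  have hp := hm.isPrime
  have h1 : b * d ∈ m := hle (Ideal.subset_span (by simp))
  have h2 : a * d + c * b ∈ m := hle (Ideal.subset_span (by simp))
  have h3 : a * c ∈ m := hle (Ideal.subset_span (by simp))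
  have key : ∀ {a b : k[X]}, IsCoprime a b → a ∈ m → b ∈ m → False := by
    rintro a b ⟨u, v, huv⟩ ha hb
    exact hm.ne_top ((Ideal.eq_top_iff_one m).2
      (huv ▸ m.add_mem (m.mul_mem_left u ha) (m.mul_mem_left v hb)))
  rcases hp.mem_or_mem h1 with hb | hd
  · have hc : c ∈ m := (hp.mem_or_mem h3).resolve_left fun ha => key hab ha hb
    have had : a * d ∈ m := (m.add_mem_iff_left (m.mul_mem_right _ hc)).1 h2
    rcases hp.mem_or_mem had with ha | hd
    · exact key hab ha hb
    · exact key hcd hc hd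
  · have ha : a ∈ m := (hp.mem_or_mem h3).resolve_right fun hc => key hcd hc hd
    have hcb : c * b ∈ m := (m.add_mem_iff_right (m.mul_mem_right _ ha)).1 h2
    rcases hp.mem_or_mem hcb with hc | hb
    · exact key hcd hc hd
    · exact key hab ha hb

theorem dvd_of_span_eq_top {R : Type*} [CommRing R] {u v w a b c : R}
    (h : Ideal.span {u, v, w} = ⊤) (hv : v * a = u * b) (hw : w * a = u * c) : u ∣ a := by
  have h1 : (1 : R) ∈ Ideal.span {u, v, w} := h ▸ Submodule.mem_top
  obtain ⟨r, z, hz, h1⟩ := Ideal.mem_span_insert.1 h1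
  obtain ⟨s, t, rfl⟩ := Ideal.mem_span_pair.1 hz
  exact ⟨r * a + s * b + t * c, by linear_combination a * h1 + s * hv + t * hw⟩

/-- The triples `(1 : f + g : f g)` and `(A : B : C)` are proportional. Coprime polynomial
representatives agree up to a unit, so the degrees of the coefficients of `(b T - a) (d T - c)` can
be read off from `A`, `B`, `C`. -/
theorem ratHeight_add_ratHeight {f g : RatFunc k} {A B C : k[X]}
    (h : Ideal.span {A, B, C} = ⊤)
    (hB : (f + g) * algebraMap _ _ A = algebraMap _ _ B)
    (hC : f * g * algebraMap _ _ A = algebraMap _ _ C) :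
    ratHeight f + ratHeight g = max (max A.natDegree B.natDegree) C.natDegree := by
  have hf := f.denom_ne_zero
  have hg := g.denom_ne_zero
  rw [ratHeight, ratHeight, ← max_natDegree_mul hf hg]
  have hf' : algebraMap k[X] (RatFunc k) f.denom ≠ 0 := by simpa using hf
  have hg' : algebraMap k[X] (RatFunc k) g.denom ≠ 0 := by simpa using hg
  have htop := span_symm_eq_top f.isCoprime_num_denom g.isCoprime_num_denom
  have hfe : f * algebraMap k[X] (RatFunc k) f.denom = algebraMap _ _ f.num := by
    nth_rw 1 [← f.num_div_denom]; field_simp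
  have hge : g * algebraMap k[X] (RatFunc k) g.denom = algebraMap _ _ g.num := by
    nth_rw 1 [← g.num_div_denom]; field_simp
  generalize f.num = a at *
  generalize f.denom = b at *
  generalize g.num = c at *
  generalize g.denom = d at *
  have hV : (a * d + c * b) * A = b * d * B := by
    apply IsFractionRing.injective k[X] (RatFunc k)
    simp only [map_mul, map_add, ← hB, ← hfe, ← hge]
    ring
  have hW : a * c * A = b * d * C := by
    apply IsFractionRing.injective k[X] (RatFunc k)
    simp only [map_mul, ← hC, ← hfe, ← hge]
    ring
  obtain ⟨u, hu⟩ := associated_of_dvd_dvd (dvd_of_span_eq_top htop hV hW)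
    (dvd_of_span_eq_top h (b := a * d + c * b) (c := a * c) (by rw [mul_comm B, ← hV]; ring)
      (by rw [mul_comm C, ← hW]; ring))
  have hbd : b * d ≠ 0 := mul_ne_zero hf hg
  have hBV : Associated (a * d + c * b) B := ⟨u, mul_left_cancel₀ hbd (by rw [← hV, ← hu]; ring)⟩
  have hCW : Associated (a * c) C := ⟨u, mul_left_cancel₀ hbd (by rw [← hW, ← hu]; ring)⟩
  rw [natDegree_eq_of_degree_eq (degree_eq_degree_of_associated ⟨u, hu⟩),
    natDegree_eq_of_degree_eq (degree_eq_degree_of_associated hBV),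
    natDegree_eq_of_degree_eq (degree_eq_degree_of_associated hCW)]

/-- The denominators of `x(P + G)` and `x(P - G)`, for `G` the generic point, do not cancel. -/
theorem span_parallelogram_eq_top (h2 : (2 : k) ≠ 0) {a b : k[X]} (hab : IsCoprime a b) :
    Ideal.span {(a - X * b) ^ 2, 2 * (a + X * b) * (a * X - b), (a * X + b) ^ 2} = ⊤ := by
  by_contra hne
  obtain ⟨m, hm, hle⟩ := Ideal.exists_le_maximal _ hne
  have hp := hm.isPrime
  have h1 : a - X * b ∈ m := hp.mem_of_pow_mem 2 (hle (Ideal.subset_span (by simp)))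
  have h2' : 2 * (a + X * b) * (a * X - b) ∈ m := hle (Ideal.subset_span (by simp))
  have h3 : a * X + b ∈ m := hp.mem_of_pow_mem 2 (hle (Ideal.subset_span (by simp)))
  have hunit : IsUnit (8 : k[X]) := by
    have h8 : (8 : k[X]) = C (2 ^ 3) := by
      rw [show (2 : k) ^ 3 = 8 by norm_num]
      rfl
    rw [h8]
    exact isUnit_C.2 (pow_ne_zero 3 h2).isUnit
  -- Modulo `a - X b` and `a X + b`, the middle generator becomes `-8 X b²`.
  have key : X * b * b ∈ m := by
    refine (hp.mem_or_mem (?_ : 8 * (X * b * b) ∈ m)).resolve_left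
      fun h8 => hm.ne_top (Ideal.eq_top_of_isUnit_mem _ h8 hunit)
    have : 8 * (X * b * b) = 4 * X * b * (a * X + b) + 2 * ((a * X + b) - 2 * b) * (a - X * b) -
        2 * (a + X * b) * (a * X - b) := by ring
    rw [this]
    exact m.sub_mem (m.add_mem (m.mul_mem_left _ h3) (m.mul_mem_left _ h1)) h2'
  have hb : b ∈ m := by
    rcases hp.mem_or_mem key with hXb | hb
    · rcases hp.mem_or_mem hXb with hX | hb
      · exact (m.add_mem_iff_right (m.mul_mem_left _ hX)).1 h3
      · exact hb
    · exact hb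
  have ha : a ∈ m := (m.sub_mem_iff_left (m.mul_mem_left _ hb)).1 h1
  obtain ⟨u, v, huv⟩ := hab
  exact hm.ne_top ((Ideal.eq_top_iff_one m).2
    (huv ▸ m.add_mem (m.mul_mem_left u ha) (m.mul_mem_left v hb)))

theorem max_natDegree_parallelogram {a b : k[X]} (hb : b ≠ 0) :
    max (max ((a - X * b) ^ 2).natDegree (2 * (a + X * b) * (a * X - b)).natDegree)
      ((a * X + b) ^ 2).natDegree = 2 * max a.natDegree b.natDegree + 2 := by
  have hXb : (X * b).natDegree = b.natDegree + 1 := natDegree_X_mul hb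
  have h1 := natDegree_sub_le a (X * b)
  have h2 := natDegree_add_le a (X * b)
  have haX : (a * X).natDegree ≤ a.natDegree + 1 :=
    natDegree_mul_le.trans (by rw [natDegree_X])
  have h3 := natDegree_sub_le (a * X) b
  have h4 := natDegree_add_le (a * X) b
  have h5 : (2 * (a + X * b) * (a * X - b)).natDegree ≤
      (a + X * b).natDegree + (a * X - b).natDegree := by
    rw [mul_assoc]
    refine natDegree_mul_le.trans ?_
    have : (2 : k[X]).natDegree = 0 := natDegree_ofNat 2
    have := natDegree_mul_le (p := a + X * b) (q := a * X - b)
    lia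
  rw [natDegree_pow, natDegree_pow]
  rcases le_or_gt b.degree a.degree with h | h
  · have ha : a ≠ 0 := by
      rintro rfl
      rw [degree_zero, le_bot_iff, degree_eq_bot] at h
      exact hb h
    have h6 := natDegree_le_natDegree h
    have h7 : (a * X + b).natDegree = a.natDegree + 1 := by
      rw [natDegree_add_eq_left_of_natDegree_lt, natDegree_mul_X ha]
      rw [natDegree_mul_X ha]
      lia
    lia
  · have h6 := natDegree_le_natDegree h.le
    have h7 : (a - X * b).natDegree = b.natDegree + 1 := by
      rw [natDegree_sub_eq_right_of_natDegree_lt, hXb]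
      lia
    lia

theorem ratHeight_parallelogram (h2 : (2 : k) ≠ 0) {f f₁ f₂ : RatFunc k}
    (hadd : (f₁ + f₂) * (f - RatFunc.X) ^ 2 = 2 * (f + RatFunc.X) * (f * RatFunc.X - 1))
    (hmul : f₁ * f₂ * (f - RatFunc.X) ^ 2 = (f * RatFunc.X + 1) ^ 2) :
    ratHeight f₁ + ratHeight f₂ = 2 * ratHeight f + 2 := by
  have hfe : f * algebraMap k[X] (RatFunc k) f.denom = algebraMap _ _ f.num := by
    have hf' : algebraMap k[X] (RatFunc k) f.denom ≠ 0 := by simpa using f.denom_ne_zero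
    nth_rw 1 [← f.num_div_denom]; field_simp
  rw [ratHeight_add_ratHeight (span_parallelogram_eq_top h2 f.isCoprime_num_denom),
    max_natDegree_parallelogram f.denom_ne_zero, ratHeight]
  · simp only [map_mul, map_add, map_sub, map_pow, map_ofNat, RatFunc.algebraMap_X, ← hfe]
    linear_combination algebraMap k[X] (RatFunc k) f.denom ^ 2 * hadd
  · simp only [map_mul, map_add, map_sub, map_pow, RatFunc.algebraMap_X, ← hfe]
    linear_combination algebraMap k[X] (RatFunc k) f.denom ^ 2 * hmul

end RationalHeight

namespace TwistPoint

variable {F : Type*} [Field F] {c : F} [NeZero c] [NeZero (2 : F)]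

/-- The sum and the product of the two x-coordinates are symmetric under `y₂ ↦ -y₂`, hence rational
in `x₁` and `x₂` alone. With `x₂ = X` they are the input of `ratHeight_parallelogram`. -/
theorem mk_add_sub_mk {x₁ y₁ x₂ y₂ : F} (h₁ : c * y₁ ^ 2 = x₁ ^ 3 - x₁)
    (h₂ : c * y₂ ^ 2 = x₂ ^ 3 - x₂) (h : x₁ ≠ x₂) :
    ∃ x₃ y₃ h₃ x₄ y₄ h₄, mk x₁ y₁ h₁ + mk x₂ y₂ h₂ = mk x₃ y₃ h₃ ∧
      mk x₁ y₁ h₁ - mk x₂ y₂ h₂ = mk x₄ y₄ h₄ ∧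
      (x₃ + x₄) * (x₁ - x₂) ^ 2 = 2 * (x₁ + x₂) * (x₁ * x₂ - 1) ∧
      x₃ * x₄ * (x₁ - x₂) ^ 2 = (x₁ * x₂ + 1) ^ 2 := by
  have hd : x₁ - x₂ ≠ 0 := sub_ne_zero.2 h
  have hl := div_mul_cancel₀ (y₁ - y₂) hd
  have hl' := div_mul_cancel₀ (y₁ - -y₂) hd
  obtain ⟨h₃, e₃⟩ := mk_add_mk_of_ne h₁ h₂ h hl
  obtain ⟨h₄, e₄⟩ := mk_add_mk_of_ne h₁ (by rw [neg_sq, h₂] : c * (-y₂) ^ 2 = _) h hl'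
  rw [← neg_mk h₂, ← sub_eq_add_neg] at e₄
  refine ⟨_, _, h₃, _, _, h₄, e₃, e₄, ?_, ?_⟩
  · field_simp
    linear_combination 2 * h₁ + 2 * h₂
  · field_simp
    linear_combination (c * y₁ ^ 2 + (x₁ ^ 3 - x₁) - 2 * c * y₂ ^ 2 -
        2 * (x₁ + x₂) * (x₁ - x₂) ^ 2) * h₁ + (c * y₂ ^ 2 + (x₂ ^ 3 - x₂) - 2 * (x₁ ^ 3 - x₁) -
        2 * (x₁ + x₂) * (x₁ - x₂) ^ 2) * h₂

end TwistPoint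

/-! ### Derivations and the additivity of the invariant differential. -/

/-- The derivative of a chord sum: on points with `x' = m y`, the factor `m` is additive. -/
theorem derivative_chord {F : Type*} [Field F] (δ : F →+ F)
    (hδ : ∀ a b, δ (a * b) = a * δ b + δ a * b) {c x₁ y₁ x₂ y₂ l m n : F}
    (h₁ : c * y₁ ^ 2 = x₁ ^ 3 - x₁) (h₂ : c * y₂ ^ 2 = x₂ ^ 3 - x₂) (h : x₁ ≠ x₂) (hy₁ : y₁ ≠ 0)
    (hy₂ : y₂ ≠ 0) (hm : δ x₁ = m * y₁) (hn : δ x₂ = n * y₂) (hl : l * (x₁ - x₂) = y₁ - y₂) :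
    δ (c * l ^ 2 - x₁ - x₂) = (m + n) * (l * (x₁ - (c * l ^ 2 - x₁ - x₂)) - y₁) := by
  have hd : x₁ - x₂ ≠ 0 := sub_ne_zero.2 h
  have hl' : c * l * (y₁ + y₂) = x₁ ^ 2 + x₁ * x₂ + x₂ ^ 2 - 1 := by
    refine mul_right_cancel₀ hd ?_
    linear_combination c * (y₁ + y₂) * hl + h₁ - h₂
  -- This is the derivative of the curve equation. The term `δ c` has to stay, since the generic
  -- coefficient depends on `X`.
  have E : ∀ {x y m : F}, c * y ^ 2 = x ^ 3 - x → y ≠ 0 → δ x = m * y →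
      δ c * y + 2 * c * δ y = (3 * x ^ 2 - 1) * m := by
    intro x y m h hy hx
    have := congrArg δ h
    rw [pow_succ, pow_one, pow_succ, pow_succ, pow_one, map_sub, hδ, hδ, hδ, hδ, hx] at this
    refine mul_right_cancel₀ hy ?_
    linear_combination this
  have E₁ := E h₁ hy₁ hm
  have E₂ := E h₂ hy₂ hn
  have hL := congrArg δ hl
  rw [hδ, map_sub, map_sub, hm, hn] at hL
  rw [map_sub, map_sub, hδ, pow_succ, pow_one, hδ, hm, hn]
  refine mul_right_cancel₀ hd ?_
  linear_combination 2 * c * l * hL + l * E₁ - l * E₂ + δ c * l * hl +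
    m * (-l * hl' + c * l ^ 2 * hl) + n * (l * hl' + c * l ^ 2 * hl - (x₁ - x₂) * hl)

section RatDeriv

open Polynomial

variable (k : Type*) [Field k]

/-- The ring homomorphism `p ↦ p + p' ε`. -/
noncomputable def polyDual : k[X] →+* TrivSqZeroExt (RatFunc k) (RatFunc k) where
  toFun p := .inl (algebraMap k[X] (RatFunc k) p) +
    .inr (algebraMap k[X] (RatFunc k) (derivative p))
  map_one' := by ext <;> simp
  map_zero' := by ext <;> simp
  map_add' p q := by
    ext
    · simp
    · simp only [TrivSqZeroExt.snd_add, TrivSqZeroExt.snd_inl, TrivSqZeroExt.snd_inr, zero_add,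
        map_add]
  map_mul' p q := by
    ext
    · simp
    · simp only [TrivSqZeroExt.snd_mul, TrivSqZeroExt.snd_add, TrivSqZeroExt.fst_add,
        TrivSqZeroExt.snd_inl, TrivSqZeroExt.snd_inr, TrivSqZeroExt.fst_inl, TrivSqZeroExt.fst_inr,
        zero_add, add_zero, map_add, map_mul, derivative_mul, smul_eq_mul,
        MulOpposite.smul_eq_mul_unop,
        MulOpposite.unop_op]
      ring

theorem polyDual_fst (p : k[X]) : (polyDual k p).fst = algebraMap _ _ p := by
  simp [polyDual]

theorem polyDual_snd (p : k[X]) : (polyDual k p).snd = algebraMap _ _ (derivative p) := by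
  simp only [polyDual, RingHom.coe_mk, MonoidHom.coe_mk, OneHom.coe_mk, TrivSqZeroExt.snd_add,
    TrivSqZeroExt.snd_inl, TrivSqZeroExt.snd_inr, zero_add]

/-- A nonzero polynomial becomes a unit in the dual numbers, so `p ↦ p + p' ε` extends to fractions;
the coefficient of `ε` is the derivation. -/
theorem exists_ratDeriv : ∃ δ : RatFunc k →+ RatFunc k,
    (∀ a b, δ (a * b) = a * δ b + δ a * b) ∧
      ∀ p : k[X], δ (algebraMap _ _ p) = algebraMap _ _ (derivative p) := by
  have hu : ∀ y : nonZeroDivisors k[X], IsUnit (polyDual k y) := fun y => by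
    rw [TrivSqZeroExt.isUnit_iff_isUnit_fst, polyDual_fst]
    exact (IsFractionRing.to_map_ne_zero_of_mem_nonZeroDivisors (K := RatFunc k) y.2).isUnit
  let g : RatFunc k →+* TrivSqZeroExt (RatFunc k) (RatFunc k) := IsLocalization.lift hu
  have hg : ∀ p : k[X], g (algebraMap _ _ p) = polyDual k p := IsLocalization.lift_eq hu
  have hfst : ∀ a, (g a).fst = a := by
    have : (TrivSqZeroExt.fstHom (RatFunc k) (RatFunc k) (RatFunc k)).toRingHom.comp g =
        RingHom.id _ := by
      refine IsLocalization.ringHom_ext (nonZeroDivisors k[X]) (RingHom.ext fun p => ?_)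
      change (g _).fst = _
      rw [hg, polyDual_fst]
      rfl
    exact fun a => RingHom.congr_fun this a
  refine ⟨(TrivSqZeroExt.sndHom (RatFunc k) (RatFunc k)).toAddMonoidHom.comp g.toAddMonoidHom,
    fun a b => ?_, fun p => ?_⟩
  · simp [TrivSqZeroExt.snd_mul, hfst, mul_comm]
  · change (g _).snd = _
    rw [hg, polyDual_snd]

end RatDeriv

/-! ### Points killed by 4. -/

namespace TwistPoint

section Torsion

variable {F : Type*} [Field F] {c : F} [NeZero c] [NeZero (2 : F)] {j : F} (hj : j ^ 2 = -1)

include hj in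
theorem four_nsmul_eq_zero {P : TwistPoint c} (h : 2 • phi c j hj (phi c j hj P) = 0) :
    4 • P = 0 := by
  have h1 : cm c j hj (4 • P) = 0 := by
    rw [← h, phi_phi, ← mul_nsmul', map_nsmul]
  have h2 := cm_cm hj (4 • P)
  rwa [h1, map_zero, eq_comm, neg_eq_zero] at h2

include hj in
theorem sqrt_neg_one_ne_zero : j ≠ 0 := by
  rintro rfl
  norm_num at hj

include hj in
-- The x-coordinate `j (1 - x²) / (2 x)` of the image has square 1, so its y-coordinate vanishes.
theorem two_nsmul_phi_eq_zero {x y : F} (h : c * y ^ 2 = x ^ 3 - x) (hx : x ^ 2 = -1) :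
    2 • phi c j hj (mk x y h) = 0 := by
  have hx0 := sqrt_neg_one_ne_zero hx
  have h2 : (2 : F) ≠ 0 := NeZero.ne _
  obtain ⟨h', he⟩ := phi_mk hj h hx0
  rw [he, two_nsmul]
  refine mk_add_mk_of_neg _ _ ?_
  generalize (1 - j) * y / (2 * x) * (x - j * (1 - x ^ 2) / (2 * x)) - y = z at *
  have h0 : c * z ^ 2 = 0 := by
    have h1 : (j * (1 - x ^ 2) / (2 * x)) ^ 2 = 1 := by
      field_simp
      linear_combination (1 - x ^ 2) ^ 2 * hj - (x ^ 2 + 1) * hx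
    rw [h']
    linear_combination (j * (1 - x ^ 2) / (2 * x)) * h1
  have hz : z = 0 := by simpa [NeZero.ne c] using h0
  rw [hz, neg_zero]

include hj in
theorem four_nsmul_mk_of_sq {x y : F} (h : c * y ^ 2 = x ^ 3 - x) (hx : x ^ 2 = -1) :
    4 • mk x y h = 0 := by
  apply four_nsmul_eq_zero hj
  rw [← map_nsmul, two_nsmul_phi_eq_zero hj h hx, map_zero]

include hj in
-- Here `1 - x² = 2 x`, so `1 + j` moves the point to one with x-coordinate `j`, and the case `x² =
-- -1` applies.
theorem four_nsmul_mk_of_sqrt_two {x y : F} (h : c * y ^ 2 = x ^ 3 - x) (hx : (x + 1) ^ 2 = 2) :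
    4 • mk x y h = 0 := by
  have hx0 : x ≠ 0 := by
    rintro rfl
    exact one_ne_zero (α := F) (by linear_combination -hx)
  have h2 : (2 : F) ≠ 0 := NeZero.ne _
  apply four_nsmul_eq_zero hj
  obtain ⟨h', he⟩ := phi_mk hj h hx0
  rw [he]
  apply two_nsmul_phi_eq_zero
  have : j * (1 - x ^ 2) / (2 * x) = j := by
    field_simp
    linear_combination -j * hx
  rw [this, hj]

end Torsion

/-! ### Degrees and derivatives of the multiples `(m + i) G` of the generic point. -/

section Generic

variable {k : Type*} [Field k]

/-- The coefficient `c` for which `(X, s)` is a point of `c y² = x³ - x`. -/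
noncomputable def genericCoeff (s : k) : RatFunc k :=
  RatFunc.C (s ^ 2)⁻¹ * (RatFunc.X ^ 3 - RatFunc.X)

theorem ratFunc_X_cube_sub_ne_zero : (RatFunc.X ^ 3 - RatFunc.X : RatFunc k) ≠ 0 := by
  have : (RatFunc.X ^ 3 - RatFunc.X : RatFunc k) =
      algebraMap (Polynomial k) _ (Polynomial.X ^ 3 - Polynomial.X) := by simp
  rw [this]
  apply IsFractionRing.to_map_ne_zero_of_mem_nonZeroDivisors
  rw [mem_nonZeroDivisors_iff_ne_zero]
  intro h0
  have := congrArg (fun p => Polynomial.coeff p 3) h0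
  simp [Polynomial.coeff_X] at this

variable (s j : k) [NeZero s] (hj : j ^ 2 = -1)

instance : NeZero (genericCoeff s) :=
  ⟨mul_ne_zero (by simp [NeZero.ne s]) ratFunc_X_cube_sub_ne_zero⟩

instance [NeZero (2 : k)] : NeZero (2 : RatFunc k) :=
  ⟨by
    rw [← map_ofNat (RatFunc.C (K := k)) 2, Ne, map_eq_zero]
    exact NeZero.ne _⟩

theorem generic_mem : genericCoeff s * RatFunc.C s ^ 2 = RatFunc.X ^ 3 - RatFunc.X := by
  rw [genericCoeff, mul_right_comm, ← map_pow, ← map_mul,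
    inv_mul_cancel₀ (pow_ne_zero 2 (NeZero.ne s)), map_one, one_mul]

variable [NeZero (2 : k)]

/-- The generic point `(X, s)`. -/
noncomputable def generic : TwistPoint (genericCoeff s) :=
  mk RatFunc.X (RatFunc.C s) (generic_mem s)

variable {j}

include hj in
theorem C_sq : (RatFunc.C j) ^ 2 = -1 := by
  rw [← map_pow, hj, map_neg, map_one]

/-- The multiple by `m + j` of the generic point. -/
noncomputable def genericMul (m : ℕ) : TwistPoint (genericCoeff s) :=
  cm _ (RatFunc.C j) (C_sq hj) (generic s) + m • generic s

theorem genericMul_zero : genericMul s hj 0 = mk (-RatFunc.X) (RatFunc.C j * RatFunc.C s)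
    (by linear_combination genericCoeff s * RatFunc.C s ^ 2 * C_sq hj - generic_mem s) := by
  rw [genericMul, zero_nsmul, add_zero, generic, cm_mk]

theorem genericMul_succ (m : ℕ) : genericMul s hj (m + 1) = genericMul s hj m + generic s := by
  rw [genericMul, genericMul, succ_nsmul, add_assoc]

theorem ratHeight_add_generic {f y : RatFunc k} {h} (hf : f ≠ RatFunc.X) :
    ∃ f₁ y₁ h₁ f₂ y₂ h₂, mk f y h + generic s = mk f₁ y₁ h₁ ∧ mk f y h - generic s = mk f₂ y₂ h₂ ∧
      ratHeight f₁ + ratHeight f₂ = 2 * ratHeight f + 2 := by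
  obtain ⟨f₁, y₁, h₁, f₂, y₂, h₂, e₁, e₂, hadd, hmul⟩ := mk_add_sub_mk h (generic_mem s) hf
  exact ⟨f₁, y₁, h₁, f₂, y₂, h₂, e₁, e₂, ratHeight_parallelogram (NeZero.ne _) hadd hmul⟩

/-- The parallelogram law is a second-order recursion in `m`, so two consecutive values are carried.
Its solution is the norm `m² + 1` of `m + i`. -/
theorem ratHeight_genericMul_aux (m : ℕ) : ∃ f y h g z h', genericMul s hj m = mk f y h ∧
    ratHeight f = m ^ 2 + 1 ∧ genericMul s hj (m + 1) = mk g z h' ∧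
    ratHeight g = (m + 1) ^ 2 + 1 ∧ f ≠ RatFunc.X := by
  have hX : (-RatFunc.X : RatFunc k) ≠ RatFunc.X := by
    intro h0
    have h1 : (2 : RatFunc k) * RatFunc.X = 0 := by linear_combination -h0
    rcases mul_eq_zero.1 h1 with h1 | h1
    · exact NeZero.ne _ h1
    · exact RatFunc.X_ne_zero h1
  induction m with
  | zero =>
    have h0 := genericMul_zero s hj
    obtain ⟨f₁, y₁, h₁, f₂, y₂, h₂, e₁, e₂, hh⟩ := ratHeight_add_generic s
      (h := by linear_combination genericCoeff s * RatFunc.C s ^ 2 * C_sq hj - generic_mem s)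
      (y := RatFunc.C j * RatFunc.C s) hX
    refine ⟨_, _, _, f₁, y₁, h₁, h0, ?_, by rw [genericMul_succ, h0, e₁], ?_, hX⟩
    · rw [ratHeight_neg, ratHeight_X]; rfl
    -- Since `i (i G + G) = i G - G`, the two x-coordinates are opposite and have equal heights,
    -- with sum 4.
    · have e₃ : cm _ (RatFunc.C j) (C_sq hj) (mk f₁ y₁ h₁) = mk f₂ y₂ h₂ := by
        rw [← e₁, ← e₂, ← h0, genericMul, zero_nsmul, add_zero, map_add, cm_cm]
        abel
      rw [cm_mk, mk_inj] at e₃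
      rw [← e₃.1, ratHeight_neg, ratHeight_neg, ratHeight_X] at hh
      lia
  | succ m ih =>
    obtain ⟨f, y, h, g, z, h', e, hf, e', hg, -⟩ := ih
    have hgX : g ≠ RatFunc.X := by
      rintro rfl
      rw [ratHeight_X] at hg
      have : 0 < (m + 1) ^ 2 := by positivity
      lia
    obtain ⟨f₁, y₁, h₁, f₂, y₂, h₂, e₁, e₂, hh⟩ := ratHeight_add_generic s (h := h') hgX
    refine ⟨g, z, h', f₁, y₁, h₁, e', hg, by rw [genericMul_succ, e', e₁], ?_, hgX⟩
    rw [← e', genericMul_succ, add_sub_cancel_right, e, mk_inj] at e₂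
    rw [← e₂.1, hf, hg] at hh
    linarith

theorem exists_genericMul (m : ℕ) : ∃ f y h, genericMul s hj m = mk f y h ∧
    ratHeight f = m ^ 2 + 1 ∧ f ≠ RatFunc.X ∧ y ≠ 0 := by
  obtain ⟨f, y, h, -, -, -, e, hf, -, -, hX⟩ := ratHeight_genericMul_aux s hj m
  refine ⟨f, y, h, e, hf, hX, ?_⟩
  rintro rfl
  have h0 : f * ((f - 1) * (f + 1)) = 0 := by linear_combination -h
  -- If `y = 0`, then `f` is one of the constants 0, 1, -1, contrary to its positive height.
  have hC : ∀ a : k, f = RatFunc.C a → False := by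
    rintro a rfl
    rw [ratHeight, RatFunc.num_C, RatFunc.denom_C, Polynomial.natDegree_C,
      Polynomial.natDegree_one] at hf
    simp at hf
  rcases mul_eq_zero.1 h0 with h0 | h0
  · exact hC 0 (by rw [h0, map_zero])
  · rcases mul_eq_zero.1 h0 with h0 | h0
    · exact hC 1 (by rw [map_one]; linear_combination h0)
    · exact hC (-1) (by rw [map_neg, map_one]; linear_combination h0)

/-- By `derivative_chord` the quotient of `δ x` by `y` is additive; it is `s⁻¹` on `G` and `j s⁻¹`
on `i G`. -/
theorem derivative_genericMul (δ : RatFunc k →+ RatFunc k)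
    (hδ : ∀ a b, δ (a * b) = a * δ b + δ a * b) (hδX : δ RatFunc.X = 1) (m : ℕ) {f y h}
    (e : genericMul s hj m = mk f y h) :
    δ f = ((m : RatFunc k) + RatFunc.C j) * RatFunc.C s⁻¹ * y := by
  have hs : RatFunc.C s⁻¹ * RatFunc.C s = 1 := by
    rw [← map_mul, inv_mul_cancel₀ (NeZero.ne s), map_one]
  induction m generalizing f y with
  | zero =>
    rw [genericMul_zero, mk_inj] at e
    rw [← e.1, ← e.2, map_neg, hδX, Nat.cast_zero]
    linear_combination -RatFunc.C j ^ 2 * hs - C_sq hj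
  | succ m ih =>
    obtain ⟨f₁, y₁, h₁, e₁, -, hX, hy⟩ := exists_genericMul s hj m
    have hl := div_mul_cancel₀ (y₁ - RatFunc.C s) (sub_ne_zero.2 hX)
    obtain ⟨h₃, e₃⟩ := mk_add_mk_of_ne h₁ (generic_mem s) hX hl
    rw [genericMul_succ, e₁, generic, e₃, mk_inj] at e
    rw [← e.1, ← e.2, derivative_chord δ hδ h₁ (generic_mem s) hX hy (by simp [NeZero.ne s])
      (ih e₁) (n := RatFunc.C s⁻¹) (by rw [hs, hδX]) hl]
    push_cast
    ring

end Generic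

end TwistPoint

/-! ### Multiplication by `M + i` is Frobenius followed by `i`. -/

namespace TwistPoint

open Polynomial

variable {k : Type*} [Field k] (s : k) {j : k} [NeZero s] (hj : j ^ 2 = -1) [NeZero (2 : k)]

theorem redTo_X (x : k) : RedTo (evalRingHom x) (RatFunc.X : RatFunc k) x := by
  simpa using RedTo.of_algebraMap (K := RatFunc k) (f := evalRingHom x) X

theorem redTo_C (x a : k) : RedTo (evalRingHom x) (RatFunc.C a : RatFunc k) a := by
  simpa using RedTo.of_algebraMap (K := RatFunc k) (f := evalRingHom x) (C a)

theorem redTo_genericCoeff {c : k} {x : k} (h : c * s ^ 2 = x ^ 3 - x) :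
    RedTo (evalRingHom x) (genericCoeff s) c := by
  have := (redTo_C x (s ^ 2)⁻¹).mul (((redTo_X x).pow 3).sub (redTo_X x))
  rwa [← h, mul_comm c, inv_mul_cancel_left₀ (pow_ne_zero 2 (NeZero.ne s))] at this

/-- The multiples of the generic point specialise to the multiples of any point. -/
theorem red_genericMul {c : k} [NeZero c] {x : k} (h : c * s ^ 2 = x ^ 3 - x) (m : ℕ) :
    Red (evalRingHom x) (genericMul s hj m) (cm c j hj (mk x s h) + m • mk x s h) := by
  have hc := redTo_genericCoeff s h
  have hg : Red (evalRingHom x) (generic s) (mk x s h) := Red.mk (redTo_X x) (redTo_C x s)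
  exact (hg.cm (C_sq hj) hj (redTo_C x j)).add hc (hg.nsmul hc m)

theorem derivative_eq_zero_of_dvd {b : k[X]} (h : b ∣ derivative b) : derivative b = 0 := by
  by_contra hne
  have h1 := natDegree_le_of_dvd h hne
  have h2 : 0 < b.natDegree := by
    by_contra h0
    rw [eq_C_of_natDegree_eq_zero (by lia : b.natDegree = 0), derivative_C] at hne
    exact hne rfl
  exact absurd (natDegree_derivative_lt h2.ne') (by lia)

/-- A rational function with zero derivative whose height is the characteristic is a fractional
linear function of `X ^ S`. -/
theorem exists_of_deriv_eq_zero {S : ℕ} [CharP k S] (hS : S ≠ 0) (δ : RatFunc k →+ RatFunc k)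
    (hδ : ∀ a b, δ (a * b) = a * δ b + δ a * b)
    (hδp : ∀ p : k[X], δ (algebraMap _ _ p) = algebraMap _ _ (derivative p))
    {f : RatFunc k} (hf : δ f = 0) (hh : ratHeight f = S) :
    ∃ a b : k[X], b ≠ 0 ∧ a.natDegree ≤ 1 ∧ b.natDegree ≤ 1 ∧
      f * algebraMap _ _ (expand k S b) = algebraMap _ _ (expand k S a) := by
  have hfe : f * algebraMap k[X] (RatFunc k) f.denom = algebraMap _ _ f.num := by
    have hf' : algebraMap k[X] (RatFunc k) f.denom ≠ 0 := by simpa using f.denom_ne_zero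
    nth_rw 1 [← f.num_div_denom]; field_simp
  have hd := congrArg δ hfe
  rw [hδ, hf, zero_mul, add_zero, hδp, hδp] at hd
  have hW : f.num * derivative f.denom = derivative f.num * f.denom := by
    apply IsFractionRing.injective k[X] (RatFunc k)
    rw [map_mul, map_mul, ← hfe, ← hd]
    ring
  have hco := f.isCoprime_num_denom
  -- By coprimality the denominator divides its own derivative, which has smaller degree unless it
  -- vanishes.
  have hb : derivative f.denom = 0 := derivative_eq_zero_of_dvd
    (hco.symm.dvd_of_dvd_mul_left ⟨derivative f.num, by rw [hW, mul_comm]⟩)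
  have ha : derivative f.num = 0 := by
    rw [hb, mul_zero, eq_comm] at hW
    exact (mul_eq_zero.1 hW).resolve_right f.denom_ne_zero
  have hea := expand_contract S ha hS
  have heb := expand_contract S hb hS
  have hda := congrArg natDegree hea
  have hdb := congrArg natDegree heb
  rw [natDegree_expand] at hda hdb
  rw [ratHeight] at hh
  refine ⟨contract S f.num, contract S f.denom, ?_, ?_, ?_, by rw [hea, heb, hfe]⟩
  · intro h0
    rw [h0, map_zero] at heb
    exact f.denom_ne_zero heb.symm
  · refine Nat.le_of_mul_le_mul_right (c := S) ?_ (by lia)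
    lia
  · refine Nat.le_of_mul_le_mul_right (c := S) ?_ (by lia)
    lia

theorem eval_eq_of_redTo {f : RatFunc k} {a b : k[X]}
    (h : f * algebraMap _ _ b = algebraMap _ _ a) {x r : k} (hr : RedTo (evalRingHom x) f r) :
    r * b.eval x = a.eval x := by
  have hb := RedTo.of_algebraMap (K := RatFunc k) (f := evalRingHom x) b
  have ha := RedTo.of_algebraMap (K := RatFunc k) (f := evalRingHom x) a
  rw [← h] at ha
  simpa using (hr.mul hb).unique ha

theorem eq_zero_of_three_roots {p : k[X]} (hp : p.natDegree ≤ 2) {x y z : k} (hxy : x ≠ y)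
    (hxz : x ≠ z) (hyz : y ≠ z) (hx : p.eval x = 0) (hy : p.eval y = 0) (hz : p.eval z = 0) :
    p = 0 := by
  classical
  refine eq_zero_of_natDegree_lt_card_of_eval_eq_zero' p {x, y, z} ?_ ?_
  · intro w hw
    simp only [Finset.mem_insert, Finset.mem_singleton] at hw
    rcases hw with rfl | rfl | rfl <;> assumption
  · rw [Finset.card_eq_three.2 ⟨x, y, z, hxy, hxz, hyz, rfl⟩]
    lia

variable {S M : ℕ} [CharP k S]

include hj in
-- The x-coordinate has height `S` and zero derivative, so it is `a(X^S) / b(X^S)` with `a`, `b` of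
-- degree at most 1. Its values at `j`, `-j` and `r - 1`, which are fixed by Frobenius and belong to
-- points killed by 4, give `a + X b` three roots. The value of `y` at `X = j` is kept in order to
-- fix a sign later.
theorem genericMul_eq_aux (hS : S.Prime) (hSM : M ^ 2 + 1 = S) (hM : 4 ∣ M) (hMj : (M : k) + j = 0)
    (hjS : j ^ S = j) {r : k} (hr : r ^ 2 = 2) (hrS : r ^ S = r) (hSodd : Odd S) :
    ∃ y e, genericMul s hj M = mk (-RatFunc.X ^ S) y e ∧ RedTo (evalRingHom j) y (j * s) := by
  have h2 : (2 : k) ≠ 0 := NeZero.ne _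
  have hs : s ≠ 0 := NeZero.ne _
  have hj0 := sqrt_neg_one_ne_zero hj
  have : Fact S.Prime := ⟨hS⟩
  obtain ⟨δ, hδ, hδp⟩ := exists_ratDeriv k
  obtain ⟨f, y, hf, e, hht, -, -⟩ := exists_genericMul s hj M
  have hδf : δ f = 0 := by
    rw [derivative_genericMul s hj δ hδ (by simpa using hδp X) M e, ← map_natCast RatFunc.C M,
      ← map_add, hMj, map_zero, zero_mul, zero_mul]
  obtain ⟨a, b, hb, hda, hdb, hab⟩ := exists_of_deriv_eq_zero hS.ne_zero δ hδ hδp hδf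
    (hht.trans hSM)
  -- the value at points killed by 4
  have hval : ∀ x : k, x ^ 3 - x ≠ 0 → x ^ S = x →
      (∀ (c : k) [NeZero c] (hc : c * s ^ 2 = x ^ 3 - x), 4 • mk x s hc = 0) →
      RedTo (evalRingHom x) y (j * s) ∧ (a + X * b).eval x = 0 := by
    intro x hx hxS h4
    -- The coefficient of the curve is free, so it is chosen to make `(x, s)` a point.
    have hc : (x ^ 3 - x) / s ^ 2 * s ^ 2 = x ^ 3 - x := by field_simp
    have : NeZero ((x ^ 3 - x) / s ^ 2) := ⟨div_ne_zero hx (pow_ne_zero 2 hs)⟩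
    have hred := red_genericMul s hj hc M
    obtain ⟨t, rfl⟩ := hM
    rw [mul_comm 4 t, mul_nsmul', h4 _ hc, nsmul_zero, add_zero, cm_mk] at hred
    obtain ⟨f', y', _, e', hf', hy'⟩ := hred.of_eq_mk rfl
    rw [mul_comm t 4, e, mk_inj] at e'
    rw [← e'.1] at hf'
    rw [← e'.2] at hy'
    refine ⟨hy', ?_⟩
    have := eval_eq_of_redTo hab hf'
    rw [expand_eval, expand_eval, hxS] at this
    rw [eval_add, eval_mul, eval_X, ← this]
    ring
  have hx1 : j ^ 3 - j ≠ 0 := by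
    rw [show j ^ 3 - j = -(2 * j) by linear_combination j * hj]
    exact neg_ne_zero.2 (mul_ne_zero h2 hj0)
  obtain ⟨hyj, hv1⟩ := hval j hx1 hjS fun c _ hc => four_nsmul_mk_of_sq hj hc hj
  have hjn : (-j) ^ 2 = -1 := by rw [neg_sq, hj]
  obtain ⟨-, hv2⟩ := hval (-j) (by
      rw [show (-j) ^ 3 - -j = -(j ^ 3 - j) by ring]
      exact neg_ne_zero.2 hx1) (by rw [hSodd.neg_pow, hjS])
    fun c _ hc => four_nsmul_mk_of_sq hj hc hjn
  have hr1 : r ≠ 1 := by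
    rintro rfl
    exact one_ne_zero (α := k) (by linear_combination -hr)
  have hrr : (r - 1) ^ 2 + 1 ≠ 0 := by
    intro h0
    have : 2 * (2 - r) = 0 := by linear_combination h0 - hr
    have h1 : r = 2 := by
      linear_combination -(mul_eq_zero.1 this).resolve_left h2
    exact h2 (by linear_combination hr - (r + 2) * h1)
  have hr2 : (r - 1) ^ 3 - (r - 1) ≠ 0 := by
    rw [show (r - 1) ^ 3 - (r - 1) = (r - 1) * (2 * (1 - r)) by linear_combination (r - 1) * hr]
    exact mul_ne_zero (sub_ne_zero.2 hr1) (mul_ne_zero h2 (sub_ne_zero.2 hr1.symm))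
  obtain ⟨-, hv3⟩ := hval (r - 1) hr2 (by rw [sub_pow_char, hrS, one_pow])
    fun c _ hc => four_nsmul_mk_of_sqrt_two hj hc (by linear_combination hr)
  have hzero : a + X * b = 0 := by
    have h12 : j ≠ -j := fun h0 => mul_ne_zero h2 hj0 (by linear_combination h0)
    have h13 : j ≠ r - 1 := fun h0 => hrr (by rw [← h0, hj]; ring)
    have h23 : -j ≠ r - 1 := fun h0 => hrr (by rw [← h0, hjn]; ring)
    refine eq_zero_of_three_roots ?_ h12 h13 h23 hv1 hv2 hv3
    have h1 := natDegree_add_le a (X * b)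
    have h2 := natDegree_mul_le (p := X) (q := b)
    rw [natDegree_X] at h2
    lia
  have hfX : f = -RatFunc.X ^ S := by
    have hb' : algebraMap k[X] (RatFunc k) (expand k S b) ≠ 0 := by
      apply IsFractionRing.to_map_ne_zero_of_mem_nonZeroDivisors
      rw [mem_nonZeroDivisors_iff_ne_zero, Ne, expand_eq_zero hS.pos]
      exact hb
    refine mul_right_cancel₀ hb' ?_
    rw [hab, eq_neg_of_add_eq_zero_left hzero, map_neg, map_mul, expand_X, map_neg, map_mul,
      map_pow,
      RatFunc.algebraMap_X, neg_mul]
  subst hfX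
  exact ⟨y, hf, e, hyj⟩

include hj in
/-- Let `S = M² + 1` be the characteristic and `M + j = 0` in `k`. Then multiplication by `M + i` on
the generic point is a Frobenius followed by multiplication by `i`. -/
theorem genericMul_eq (hS : S.Prime) (hSM : M ^ 2 + 1 = S) (hM : 4 ∣ M) (hMj : (M : k) + j = 0)
    (hjS : j ^ S = j) {r : k} (hr : r ^ 2 = 2) (hrS : r ^ S = r) (h : ℕ) (hh : S = 2 * h + 1) :
    ∃ e, genericMul s hj M = mk (-RatFunc.X ^ S)
      (RatFunc.C j * RatFunc.C s * (RatFunc.X ^ 3 - RatFunc.X) ^ h) e := by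
  have h2 : (2 : k) ≠ 0 := NeZero.ne _
  have hs : s ≠ 0 := NeZero.ne _
  have hj0 := sqrt_neg_one_ne_zero hj
  have : Fact S.Prime := ⟨hS⟩
  have : CharP (RatFunc k) S := charP_of_injective_algebraMap (algebraMap k (RatFunc k)).injective S
  obtain ⟨y, hf, e, hyj⟩ := genericMul_eq_aux s hj hS hSM hM hMj hjS hr hrS ⟨h, hh⟩
  have hysq : y ^ 2 = (RatFunc.C j * RatFunc.C s * (RatFunc.X ^ 3 - RatFunc.X) ^ h) ^ 2 := by
    refine mul_left_cancel₀ (NeZero.ne (genericCoeff s)) ?_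
    have h1 : (RatFunc.X ^ 3 - RatFunc.X : RatFunc k) ^ S =
        (RatFunc.X ^ S) ^ 3 - RatFunc.X ^ S := by
      rw [sub_pow_char, ← pow_mul, ← pow_mul, mul_comm]
    have h2 := generic_mem s
    have h3 : (RatFunc.X ^ 3 - RatFunc.X : RatFunc k) ^ S =
        (RatFunc.X ^ 3 - RatFunc.X) * ((RatFunc.X ^ 3 - RatFunc.X) ^ h) ^ 2 := by
      rw [hh, ← pow_mul, mul_comm h 2, pow_succ, mul_comm]
    rw [hf, mul_pow, mul_pow, C_sq hj]
    linear_combination h1 - h3 + ((RatFunc.X ^ 3 - RatFunc.X) ^ h) ^ 2 * h2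
  have hval_y : RedTo (evalRingHom j)
      (RatFunc.C j * RatFunc.C s * (RatFunc.X ^ 3 - RatFunc.X) ^ h) (j * s) := by
    have := ((redTo_C j j).mul (redTo_C j s)).mul ((((redTo_X j).pow 3).sub (redTo_X j)).pow h)
    have h1j : 1 - j ≠ 0 := by
      intro h0
      exact h2 (by linear_combination (1 + j) * h0 + hj)
    -- Here `j³ - j = -2 j = (1 - j)²`, and `(1 - j)^(2 h) = (1 - j)^(S - 1) = 1` because `j` is
    -- fixed by Frobenius.
    have hone : (j ^ 3 - j) ^ h = 1 := by
      rw [show j ^ 3 - j = (1 - j) ^ 2 by linear_combination (j - 1) * hj, ← pow_mul]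
      refine mul_right_cancel₀ h1j ?_
      rw [← pow_succ, ← hh, sub_pow_char, one_pow, hjS, one_mul]
    rwa [hone, mul_one] at this
  have hy : y = RatFunc.C j * RatFunc.C s * (RatFunc.X ^ 3 - RatFunc.X) ^ h := by
    rcases sq_eq_sq_iff_eq_or_eq_neg.1 hysq with h0 | h0
    · exact h0
    · rw [h0] at hyj
      have := hyj.unique hval_y.neg
      refine absurd (?_ : 2 * (j * s) = 0) (mul_ne_zero h2 (mul_ne_zero hj0 hs))
      linear_combination this
  subst hy
  exact ⟨hf, e⟩

/-- The generic point is taken with second coordinate `s = y` and specialised at `X = x`. Since `c^h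
= 1`, the factor `(x³ - x)^h` equals `y^(2 h) = y^(S - 1)`. -/
theorem nsmul_add_cm_eq (hS : S.Prime) (hSM : M ^ 2 + 1 = S) (hM : 4 ∣ M) (hMj : (M : k) + j = 0)
    (hjS : j ^ S = j) {r : k} (hr : r ^ 2 = 2) (hrS : r ^ S = r) {h : ℕ} (hh : S = 2 * h + 1)
    {c : k} [NeZero c] (hc : c ^ h = 1) {x y : k} (hxy : c * y ^ 2 = x ^ 3 - x) (hy : y ≠ 0) :
    ∃ e, M • mk x y hxy + cm c j hj (mk x y hxy) = mk (-x ^ S) (j * y ^ S) e := by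
  have : NeZero y := ⟨hy⟩
  obtain ⟨e, he⟩ := genericMul_eq y hj hS hSM hM hMj hjS hr hrS h hh
  have hred := red_genericMul y hj hxy M
  rw [he] at hred
  have hX := ((redTo_X x).pow S).neg
  have hY := ((redTo_C x j).mul (redTo_C x y)).mul ((((redTo_X x).pow 3).sub (redTo_X x)).pow h)
  obtain ⟨e', he'⟩ := Red.exists_of_mk e (redTo_genericCoeff y hxy) hX hY
  have hyS : j * y * (x ^ 3 - x) ^ h = j * y ^ S := by
    rw [← hxy, mul_pow, hc, ← pow_mul, hh, pow_succ]
    ring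
  have := hred.unique he'
  rw [add_comm, this]
  simp only [hyS] at e' ⊢
  exact ⟨e', trivial⟩

end TwistPoint

/-! ### Dividing `(5, 2)` by `1 + i` and iterating. -/

namespace TwistPoint

section Iterates

variable {F : Type*} [Field F] {c : F} [NeZero c] [NeZero (2 : F)] {j : F} (hj : j ^ 2 = -1)

theorem phi_four (P : TwistPoint c) :
    phi c j hj (phi c j hj (phi c j hj (phi c j hj P))) = -(4 • P) := by
  rw [phi_phi, phi_phi, map_nsmul, cm_cm, ← mul_nsmul', neg_nsmul]

theorem phi_iterate_four_mul (n : ℕ) (P : TwistPoint c) :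
    (phi c j hj)^[4 * n] P = 4 ^ n • P ∨ (phi c j hj)^[4 * n] P = -(4 ^ n • P) := by
  induction n with
  | zero => left; simp
  | succ n ih =>
    rw [show 4 * (n + 1) = 4 * n + 1 + 1 + 1 + 1 by ring, Function.iterate_succ_apply',
      Function.iterate_succ_apply', Function.iterate_succ_apply', Function.iterate_succ_apply',
      phi_four, pow_succ, mul_nsmul']
    rcases ih with h | h
    · right
      rw [h, ← mul_nsmul', ← mul_nsmul', mul_comm]
    · left
      rw [h, neg_nsmul, neg_neg, ← mul_nsmul', ← mul_nsmul', mul_comm]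

theorem mk_add_origin {x y : F} (h : c * y ^ 2 = x ^ 3 - x) (hx : x ≠ 0) :
    ∃ h', mk x y h + origin c = mk (-x⁻¹) (y / x ^ 2) h' := by
  have h0 : c * (0 : F) ^ 2 = 0 ^ 3 - 0 := by ring
  obtain ⟨h', he⟩ := mk_add_mk_of_ne h h0 hx (l := y / x) (by field_simp; ring)
  have hX : c * (y / x) ^ 2 - x - 0 = -x⁻¹ := by
    field_simp
    linear_combination h
  have hY : y / x * (x - (c * (y / x) ^ 2 - x - 0)) - y = y / x ^ 2 := by
    rw [hX]
    field_simp
    ring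
  have h'' := h'
  rw [hY, hX] at h''
  refine ⟨h'', ?_⟩
  rw [origin, he, mk_inj]
  exact ⟨hX, hY⟩

end Iterates

theorem mk_five_two {k : Type*} [Field k] : (30 : k) * 2 ^ 2 = 5 ^ 3 - 5 := by norm_num

section Division

variable {k : Type*} [Field k] [IsAlgClosed k] {j : k} (hj : j ^ 2 = -1) [NeZero (2 : k)]
  [NeZero (30 : k)] {S M : ℕ} [CharP k S]

include hj in
-- The preimages of `x = 5` solve `u² - 10 j u - 1 = 0`, whose roots are `5 j ± √-24`. The second
-- equation expresses `v` through `u` and `j`; it is what determines the Frobenius image of `v`.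
theorem exists_phi_eq {w : k} (hw : w ^ 2 = -24) (hu : 5 * j + w ≠ 0) :
    ∃ v h, phi (30 : k) j hj (mk (5 * j + w) v h) = mk 5 2 mk_five_two ∧
      v * (-(1 + j) * (5 * j + w) - 5 * (1 - j)) = 4 * (5 * j + w) := by
  have h2 : (2 : k) ≠ 0 := NeZero.ne _
  have h30 : (30 : k) ≠ 0 := NeZero.ne _
  set u := 5 * j + w with hudef
  have huu : u ^ 2 = 10 * j * u + 1 := by
    rw [hudef]
    linear_combination hw - 25 * hj
  have hx : j * (1 - u ^ 2) / (2 * u) = 5 := by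
    field_simp
    linear_combination -j * huu - 10 * u * hj
  obtain ⟨v₀, hv₀⟩ := IsAlgClosed.exists_pow_nat_eq ((u ^ 3 - u) / 30) (n := 2) (by norm_num)
  have key : ∀ v, v ^ 2 = (u ^ 3 - u) / 30 → ∃ h y h',
      phi (30 : k) j hj (mk u v h) = mk 5 y h' ∧
      y = (1 - j) * v / (2 * u) * (u - 5) - v := by
    intro v hv
    have h : 30 * v ^ 2 = u ^ 3 - u := by rw [hv]; field_simp
    obtain ⟨h', he⟩ := phi_mk hj h hu
    simp only [hx] at h' he
    exact ⟨h, _, h', he, rfl⟩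
  have hlin : ∀ v, 2 = (1 - j) * v / (2 * u) * (u - 5) - v →
      v * (-(1 + j) * u - 5 * (1 - j)) = 4 * u := by
    intro v hv
    field_simp at hv
    linear_combination -hv
  -- The image is `(5, 2)` or `(5, -2)`; in the second case `v₀` is replaced by `-v₀`.
  obtain ⟨h, y, h', he, hy⟩ := key v₀ hv₀
  have hy2 : 30 * ((y - 2) * (y + 2)) = 0 := by linear_combination h'
  rcases mul_eq_zero.1 ((mul_eq_zero.1 hy2).resolve_left h30) with h0 | h0
  · obtain rfl : y = 2 := sub_eq_zero.1 h0
    exact ⟨v₀, h, he, hlin v₀ hy⟩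
  · obtain rfl : y = -2 := eq_neg_of_add_eq_zero_left h0
    obtain ⟨g, z, g', ge, hz⟩ := key (-v₀) (by rw [neg_sq, hv₀])
    obtain rfl : z = 2 := by linear_combination hz + hy
    exact ⟨-v₀, g, ge, hlin _ hz⟩

include hj in
-- Frobenius changes the sign of `w = √-24`, so `u = 5 j + w` goes to `5 j - w = -1 / u` and `v`
-- goes to `v / u²`. These are the coordinates of `P + (0, 0)`. Hence `(M + i) P = i (P + (0, 0)) =
-- i P + (0, 0)`.
theorem exists_phi_eq_nsmul_eq_origin (hS : S.Prime) (hSM : M ^ 2 + 1 = S) (hM : 4 ∣ M)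
    (hMj : (M : k) + j = 0) (hjS : j ^ S = j) {r : k} (hr : r ^ 2 = 2) (hrS : r ^ S = r) {h : ℕ}
    (hh : S = 2 * h + 1) (h30 : (30 : k) ^ h = 1) (h24 : (-24 : k) ^ h = -1) :
    ∃ P : TwistPoint (30 : k), phi (30 : k) j hj P = mk 5 2 mk_five_two ∧ M • P = origin 30 := by
  have : Fact S.Prime := ⟨hS⟩
  have h2 : (2 : k) ≠ 0 := NeZero.ne _
  obtain ⟨w, hw⟩ := IsAlgClosed.exists_pow_nat_eq (-24 : k) (n := 2) (by norm_num)
  have hwS : w ^ S = -w := by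
    rw [hh, pow_succ, pow_mul, hw, h24, neg_one_mul]
  have hnat : ∀ m : ℕ, (m : k) ^ S = m := fun m => by
    rw [← frobenius_def, map_natCast]
  have h5 : (5 : k) ^ S = 5 := by exact_mod_cast hnat 5
  have huS : (5 * j + w) ^ S = 5 * j - w := by
    rw [add_pow_char, mul_pow, h5, hjS, hwS, sub_eq_add_neg]
  have hprod : (5 * j + w) * (5 * j - w) = -1 := by linear_combination 25 * hj - hw
  have hu : 5 * j + w ≠ 0 := by
    intro h0
    rw [h0, zero_mul] at hprod
    exact one_ne_zero (α := k) (by linear_combination hprod)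
  obtain ⟨v, hv, he, hlin⟩ := exists_phi_eq hj hw hu
  have huu : (5 * j + w) ^ 2 = 10 * j * (5 * j + w) + 1 := by linear_combination hw - 25 * hj
  refine ⟨_, he, ?_⟩
  have hFj : frobenius k S j = j := hjS
  have hFw : frobenius k S w = -w := hwS
  have hlinS := congrArg (frobenius k S) hlin
  simp only [map_mul, map_sub, map_neg, map_add, map_one, map_ofNat, hFj, hFw] at hlinS
  rw [frobenius_def] at hlinS
  generalize hudef : 5 * j + w = u at *
  have h4 : (4 : k) ≠ 0 := by
    rw [show (4 : k) = 2 * 2 by norm_num]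
    exact mul_ne_zero h2 h2
  have hA : v ^ S * ((1 + j) - 5 * (1 - j) * u) = -4 := by
    linear_combination u * hlinS + (v ^ S * (1 + j) + 4) * hprod
  have hB : v * ((1 + j) - 5 * (1 - j) * u) = -4 * u ^ 2 := by
    linear_combination -u * hlin - v * (1 + j) * huu - 10 * v * u * hj
  have hA0 : (1 + j) - 5 * (1 - j) * u ≠ 0 := by
    intro h0
    rw [h0, mul_zero] at hA
    exact h4 (by linear_combination hA)
  have hvS : v ^ S = v / u ^ 2 := by
    rw [eq_div_iff (pow_ne_zero 2 hu)]
    refine mul_right_cancel₀ hA0 ?_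
    linear_combination u ^ 2 * hA - hB
  have hv0 : v ≠ 0 := by
    rintro rfl
    rw [zero_mul] at hlin
    exact mul_ne_zero h4 hu hlin.symm
  have huS' : u ^ S = -u⁻¹ := by
    rw [huS]
    field_simp
    linear_combination hprod
  obtain ⟨e₁, he₁⟩ := nsmul_add_cm_eq hj hS hSM hM hMj hjS hr hrS hh h30 hv hv0
  obtain ⟨e₂, he₂⟩ := mk_add_origin hv hu
  have he₃ := congrArg (cm (30 : k) j hj) he₂
  rw [map_add, cm_origin, cm_mk hj e₂] at he₃
  have he₄ : M • mk u v hv + cm 30 j hj (mk u v hv) = cm 30 j hj (mk u v hv) + origin 30 := by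
    rw [he₁, he₃, mk_inj, huS', hvS]
    exact ⟨rfl, rfl⟩
  rw [add_comm] at he₄
  exact add_left_cancel he₄

include hj in
/-- If `S = M² + 1` is prime, `M = p 4ⁿ`, then `(1 + i)^(4 n - 1) p (5, 2)` is the origin. -/
theorem phi_iterate_eq_origin {p n : ℕ} (hn : 1 ≤ n) (hS : S.Prime)
    (hSM : (p * 4 ^ n) ^ 2 + 1 = S) (hMj : ((p * 4 ^ n : ℕ) : k) + j = 0) (hjS : j ^ S = j) {r : k}
    (hr : r ^ 2 = 2) (hrS : r ^ S = r) {h : ℕ} (hh : S = 2 * h + 1) (h30 : (30 : k) ^ h = 1)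
    (h24 : (-24 : k) ^ h = -1) :
    (phi (30 : k) j hj)^[4 * n - 1] (p • mk 5 2 mk_five_two) = origin 30 := by
  obtain ⟨P, hP, hPM⟩ := exists_phi_eq_nsmul_eq_origin hj hS hSM
    (Dvd.dvd.mul_left (dvd_pow_self 4 (by lia)) p) hMj hjS hr hrS hh h30 h24
  have ho : -origin (30 : k) = origin 30 := by
    rw [origin, neg_mk, mk_inj]
    exact ⟨rfl, neg_zero⟩
  -- Writing `(5, 2)` as `φ P` supplies the factor that completes `4 n - 1` to `4 n`; the sign in
  -- `φ^(4n) = ± 4ⁿ` is harmless, since the origin is its own negative.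
  rw [← hP, ← map_nsmul, ← Function.iterate_succ_apply, show (4 * n - 1).succ = 4 * n by lia]
  rw [mul_comm, mul_nsmul'] at hPM
  rcases phi_iterate_four_mul hj n (p • P) with h | h
  · rw [h, hPM]
  · rw [h, hPM, ho]

end Division

end TwistPoint

/-! ### A lower bound for the order of the group. -/

/-- The kernels of the iterates grow strictly up to exponent `N + 1`, since `f^[N - m] a` is killed
by `f^[m + 1]` but not by `f^[m]`. Each index is therefore at least 2. -/
theorem two_pow_le_card_of_iterate {A : Type*} [AddCommGroup A] [Finite A] (f : A →+ A) (a : A)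
    (N : ℕ) (hN : f^[N] a ≠ 0) (hN' : f^[N + 1] a = 0) : 2 ^ (N + 1) ≤ Nat.card A := by
  let K : ℕ → AddSubgroup A := fun m =>
    { carrier := {b | f^[m] b = 0}
      zero_mem' := iterate_map_zero f m
      add_mem' := fun {a b} ha hb => by
        rw [Set.mem_ofPred_eq] at *
        rw [iterate_map_add, ha, hb, add_zero]
      neg_mem' := fun {a} ha => by
        rw [Set.mem_ofPred_eq] at *
        rw [iterate_map_neg, ha, neg_zero] }
  have hK : ∀ m b, b ∈ K m ↔ f^[m] b = 0 := fun m b => Iff.rfl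
  have hcard : ∀ m ≤ N + 1, 2 ^ m ≤ Nat.card (K m) := by
    intro m
    induction m with
    | zero => intro _; exact Nat.card_pos
    | succ m ih =>
      intro hm
      have hle : K m ≤ K (m + 1) := fun b hb => by
        rw [hK] at hb ⊢
        rw [Function.iterate_succ_apply', hb, map_zero]
      have hne : Nat.card (K m) ≠ Nat.card (K (m + 1)) := fun he => by
        have heq := AddSubgroup.eq_of_le_of_card_ge hle he.ge
        have h1 : f^[N - m] a ∈ K (m + 1) := by
          rw [hK, ← Function.iterate_add_apply, show m + 1 + (N - m) = N + 1 by lia, hN']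
        rw [← heq, hK, ← Function.iterate_add_apply, show m + (N - m) = N by lia] at h1
        exact hN h1
      obtain ⟨t, ht⟩ := AddSubgroup.card_dvd_of_le hle
      have hpos : 0 < Nat.card (K (m + 1)) := Nat.card_pos
      have h2 : 2 ≤ t := by
        by_contra h
        interval_cases t
        · lia
        · exact hne (by lia)
      rw [ht, pow_succ]
      exact Nat.mul_le_mul (ih (by lia)) h2
  exact (hcard _ le_rfl).trans 
    (Nat.card_le_card_of_injective Subtype.val Subtype.val_injective)

/-! ### Transfer from `E30` to the twists. -/

namespace E30

variable {K : Type*} [Field K] [NeZero (30 : K)] [NeZero (2 : K)]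

/-- The points of `E₃₀` as a special case of the points of the twists. -/
noncomputable def toTwist : E30 K → TwistPoint (30 : K)
  | infty => 0
  | affine x y h => TwistPoint.mk x y h

theorem toTwist_affine {x y : K} (h : 30 * y ^ 2 = x ^ 3 - x) :
    toTwist (affine x y h) = TwistPoint.mk x y h := rfl

theorem eq_affine_of_toTwist {P : E30 K} {x y : K} {h : 30 * y ^ 2 = x ^ 3 - x}
    (hP : toTwist P = TwistPoint.mk x y h) : P = affine x y h := by
  rcases P with _ | ⟨x', y', h'⟩
  · exact absurd hP.symm (TwistPoint.mk_ne_zero h)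
  · rw [toTwist_affine, TwistPoint.mk_inj] at hP
    obtain ⟨rfl, rfl⟩ := hP
    rfl

theorem slope_spec {x₁ y₁ x₂ y₂ : K} (h₁ : 30 * y₁ ^ 2 = x₁ ^ 3 - x₁)
    (h₂ : 30 * y₂ ^ 2 = x₂ ^ 3 - x₂) (h : ¬(x₁ = x₂ ∧ y₁ = -y₂)) :
    slope x₁ y₁ x₂ y₂ * (x₁ - x₂) = y₁ - y₂ ∧
      30 * slope x₁ y₁ x₂ y₂ * (y₁ + y₂) = x₁ ^ 2 + x₁ * x₂ + x₂ ^ 2 - 1 := by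
  obtain ⟨l, hl, hl'⟩ := TwistPoint.exists_slope h₁ h₂ h
  suffices slope x₁ y₁ x₂ y₂ = l from this ▸ ⟨hl, hl'⟩
  by_cases hx : x₁ = x₂
  · subst hx
    have hy : y₁ = y₂ := by linear_combination -hl
    subst hy
    have hy0 : y₁ ≠ 0 := fun h0 => h ⟨rfl, by rw [h0, neg_zero]⟩
    have h60 : (60 : K) * y₁ ≠ 0 := mul_ne_zero (by
      rw [show (60 : K) = 2 * 30 by norm_num]
      exact mul_ne_zero (NeZero.ne _) (NeZero.ne _)) hy0
    rw [slope, if_pos rfl, div_eq_iff h60]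
    linear_combination -hl'
  · rw [slope, if_neg hx, div_eq_iff (sub_ne_zero.2 hx), hl]

theorem toTwist_add (P Q : E30 K) : toTwist (P + Q) = toTwist P + toTwist Q := by
  rcases P with _ | ⟨x₁, y₁, h₁⟩
  · change toTwist (0 + Q) = 0 + toTwist Q
    rw [zero_add, zero_add]
  rcases Q with _ | ⟨x₂, y₂, h₂⟩
  · change toTwist (affine x₁ y₁ h₁ + 0) = toTwist (affine x₁ y₁ h₁) + 0
    rw [add_zero, add_zero]
  change toTwist (E30.add (affine x₁ y₁ h₁) (affine x₂ y₂ h₂)) = _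
  by_cases h : x₁ = x₂ ∧ y₁ = -y₂
  · rw [E30.add, dif_pos h]
    obtain ⟨rfl, hy⟩ := h
    exact (TwistPoint.mk_add_mk_of_neg h₁ h₂ hy).symm
  · obtain ⟨hl, hl'⟩ := slope_spec h₁ h₂ h
    rw [E30.add, dif_neg h]
    exact (TwistPoint.mk_add_mk h₁ h₂ h hl hl').symm

theorem toTwist_nsmul (n : ℕ) (P : E30 K) : toTwist (n • P) = n • toTwist P := by
  induction n with
  | zero => rw [zero_nsmul, zero_nsmul]; rfl
  | succ n ih => rw [succ_nsmul, succ_nsmul, toTwist_add, ih]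

variable [Algebra GaussianInt K]

theorem toTwist_mulI (P : E30 K) :
    toTwist (mulI P) = TwistPoint.cm 30 (imag K) imag_sq (toTwist P) := by
  rcases P with _ | ⟨x, y, h⟩
  · exact (map_zero _).symm
  · exact (TwistPoint.cm_mk imag_sq h).symm

theorem toTwist_pow_smul (N : ℕ) (P : E30 K) : toTwist ((⟨1, 1⟩ : GaussianInt) ^ N • P) =
    (TwistPoint.phi 30 (imag K) imag_sq)^[N] (toTwist P) := by
  induction N with
  | zero => rw [pow_zero, one_smul]; rfl
  | succ N ih =>
    rw [pow_succ', mul_smul, Function.iterate_succ_apply', ← ih]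
    generalize (⟨1, 1⟩ : GaussianInt) ^ N • P = Q
    change toTwist ((1 : ℤ) • Q + (1 : ℤ) • mulI Q) = _
    rw [one_zsmul, one_zsmul, toTwist_add, toTwist_mulI]
    rfl

end E30

instance : CharZero QI :=
  charZero_of_injective_algebraMap (IsFractionRing.injective GaussianInt QI)

instance : NeZero (2 : QI) := ⟨two_ne_zero⟩

/-! ### Congruences modulo `α` and reduction to a field. -/

section Residue

open E30 TwistPoint

variable {k : Type*} [Field k] (f : GaussianInt →+* k) {α : GaussianInt} (hα : f α = 0)

include hα in
/-- The homomorphism from the residue ring induced by a homomorphism that kills `α`. -/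
def residueHom : ResidueRing α →+* k :=
  Ideal.Quotient.lift (Ideal.span {α}) f fun z hz => by
    obtain ⟨w, rfl⟩ := Ideal.mem_span_singleton.1 hz
    rw [map_mul, hα, zero_mul]

theorem residueHom_mk (z : GaussianInt) : residueHom f hα (Ideal.Quotient.mk _ z) = f z := rfl

theorem gaussian_map_I_sq : f ⟨0, 1⟩ ^ 2 = -1 := by
  rw [← map_pow, show (⟨0, 1⟩ : GaussianInt) ^ 2 = -1 by decide, map_neg, map_one]

include hα in
theorem map_ne_zero_of_isCoprime {d : GaussianInt} (h : IsCoprime d α) : f d ≠ 0 := by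
  obtain ⟨u, v, huv⟩ := h
  intro h0
  have := congrArg f huv
  simp [hα, h0] at this

theorem ReducesTo.redTo {x : QI} {c : ResidueRing α} (h : ReducesTo α x c) :
    RedTo f x (residueHom f hα c) := by
  obtain ⟨a, d, hd, h, h'⟩ := h
  refine ⟨a, d, map_ne_zero_of_isCoprime f hα hd, h, ?_⟩
  rw [← residueHom_mk f hα, ← residueHom_mk f hα, ← h', map_mul]

variable [NeZero (30 : k)] [NeZero (2 : k)]

theorem redTo_imag : RedTo f (imag QI) (f ⟨0, 1⟩) := RedTo.of_algebraMap _

include hα in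
theorem PointCongr.eq_origin {P : E30 QI} {Q : TwistPoint (30 : k)} (h : PointCongr α P 0 0)
    (hQ : Red f (toTwist P) Q) : Q = origin 30 := by
  obtain ⟨x, y, h, rfl, hx, hy⟩ := h
  have hx := hx.redTo f hα
  have hy := hy.redTo f hα
  rw [map_zero] at hx hy
  exact hQ.unique (Red.mk (h := h) hx hy)

include hα in
-- The sequence gives the x-coordinates of the points `φ^j Q`; invertibility of `2 x_j` allows the
-- formula for `φ` at each step. The y-coordinate need not be followed, because the only point with
-- `x = 0` is the origin.
theorem IterEndsAt.iterate_eq_origin {P : E30 QI} {N : ℕ} {Q : TwistPoint (30 : k)}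
    (h : IterEndsAt α P N 0) (hQ : Red f (toTwist P) Q) :
    (phi 30 (f ⟨0, 1⟩) (gaussian_map_I_sq f))^[N] Q = origin 30 := by
  obtain ⟨x, ⟨x₀, y₀, h, rfl, hx₀⟩, hstep, hN⟩ := h
  have key : ∀ j ≤ N, ∃ y h, (phi 30 (f ⟨0, 1⟩) (gaussian_map_I_sq f))^[j] Q =
      mk (residueHom f hα (x j)) y h := by
    intro j
    induction j with
    | zero =>
      intro _
      obtain ⟨y', h', -, hr⟩ := Red.exists_of_left h (RedTo.ofNat 30) (hx₀.redTo f hα)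
      exact ⟨y', h', hQ.unique hr⟩
    | succ j ih =>
      intro hj
      obtain ⟨y, h, he⟩ := ih (by lia)
      obtain ⟨hu, hs⟩ := hstep j (by lia)
      have hu' := (hu.map (residueHom f hα)).ne_zero
      rw [map_mul, map_ofNat] at hu'
      obtain ⟨h', he'⟩ := phi_mk (gaussian_map_I_sq f) h (right_ne_zero_of_mul hu')
      have hx : f ⟨0, 1⟩ * (1 - residueHom f hα (x j) ^ 2) / (2 * residueHom f hα (x j)) =
          residueHom f hα (x (j + 1)) := by
        rw [div_eq_iff hu']
        have := congrArg (residueHom f hα) hs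
        rw [map_mul, map_mul, map_mul, map_sub, map_pow, map_one, map_ofNat, residueHom_mk] at this
        rw [← this, mul_comm]
      rw [Function.iterate_succ_apply', he, he']
      simp only [hx] at h' ⊢
      exact ⟨_, h', rfl⟩
  obtain ⟨y, h, he⟩ := key N le_rfl
  simp only [hN, map_zero] at h he
  rw [he, mk_zero_left]

variable (hker : ∀ z, f z = 0 → α ∣ z)

include hker in
theorem residueHom_injective : Function.Injective (residueHom f hα) := by
  rw [injective_iff_map_eq_zero]
  intro c hc
  obtain ⟨z, rfl⟩ := Ideal.Quotient.mk_surjective c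
  rw [residueHom_mk] at hc
  exact Ideal.Quotient.eq_zero_iff_mem.2 (Ideal.mem_span_singleton.2 (hker z hc))

variable (hα0 : α ≠ 0)

include hα hker hα0 in
-- When `α` generates the kernel of a map to a field, it is prime, so not being divisible by `α`
-- means being coprime to it.
theorem isCoprime_of_map_ne_zero {d : GaussianInt} (hd : f d ≠ 0) : IsCoprime d α := by
  have hp : Prime α := by
    refine ⟨hα0, fun hu => (hu.map f).ne_zero hα, fun a b ⟨c, hc⟩ => ?_⟩
    have h0 : f a * f b = 0 := by rw [← map_mul, hc, map_mul, hα, zero_mul]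
    exact (mul_eq_zero.1 h0).imp (hker a) (hker b)
  refine ((hp.irreducible.coprime_iff_not_dvd).2 ?_).symm
  rintro ⟨w, rfl⟩
  rw [map_mul, hα, zero_mul] at hd
  exact hd rfl

include hker hα0 in
theorem isUnit_of_residueHom_ne_zero {c : ResidueRing α} (hc : residueHom f hα c ≠ 0) :
    IsUnit c := by
  obtain ⟨z, rfl⟩ := Ideal.Quotient.mk_surjective c
  rw [residueHom_mk] at hc
  obtain ⟨u, v, huv⟩ := isCoprime_of_map_ne_zero f hα hker hα0 hc
  refine IsUnit.of_mul_eq_one (Ideal.Quotient.mk _ u) ?_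
  rw [← map_mul, ← map_one (Ideal.Quotient.mk _), Ideal.Quotient.mk_eq_mk_iff_sub_mem,
    Ideal.mem_span_singleton]
  exact ⟨-v, by linear_combination huv⟩

include hker hα0 in
theorem RedTo.exists_residue {x : QI} {r : k} (h : RedTo f x r) :
    ∃ c : ResidueRing α, residueHom f hα c = r := by
  obtain ⟨a, d, hd, -, h'⟩ := h
  obtain ⟨u, v, huv⟩ := isCoprime_of_map_ne_zero f hα hker hα0 hd
  refine ⟨Ideal.Quotient.mk _ (u * a), ?_⟩
  have h1 := congrArg f huv
  rw [map_add, map_mul, map_mul, hα, map_one] at h1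
  rw [residueHom_mk, map_mul, ← h']
  linear_combination r * h1

include hker hα0 in
theorem RedTo.reducesTo {x : QI} {c : ResidueRing α} (h : RedTo f x (residueHom f hα c)) :
    ReducesTo α x c := by
  obtain ⟨a, d, hd, h, h'⟩ := h
  refine ⟨a, d, isCoprime_of_map_ne_zero f hα hker hα0 hd, h,
    residueHom_injective f hα hker ?_⟩
  rw [map_mul, residueHom_mk, residueHom_mk, h']

include hα hker hα0 in
theorem pointCongr_of_red {P : E30 QI} (h : Red f (toTwist P) (origin (30 : k))) :
    PointCongr α P 0 0 := by
  obtain ⟨x, y, h, he, hx, hy⟩ := h.of_eq_mk rfl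
  refine ⟨x, y, h, eq_affine_of_toTwist he, RedTo.reducesTo f hα hker hα0 ?_,
    RedTo.reducesTo f hα hker hα0 ?_⟩
  · rwa [map_zero]
  · rwa [map_zero]

theorem Red.iterate_phi {P : TwistPoint (30 : QI)} {Q : TwistPoint (30 : k)} (h : Red f P Q)
    (N : ℕ) : Red f ((phi 30 (imag QI) imag_sq)^[N] P)
      ((phi 30 (f ⟨0, 1⟩) (gaussian_map_I_sq f))^[N] Q) := by
  induction N with
  | zero => exact h
  | succ N ih =>
    rw [Function.iterate_succ_apply', Function.iterate_succ_apply']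
    exact ih.phi (RedTo.ofNat 30) _ _ (redTo_imag f)

include hα hker hα0 in
-- If an iterate were 0, or were the origin before step `N`, then the last iterate would be 0. So
-- all x-coordinates exist, and those before step `N` are nonzero, which makes the denominators
-- invertible.
theorem iterEndsAt_of_red {P : E30 QI} {N : ℕ} {Q : TwistPoint (30 : k)}
    (hQ : Red f (toTwist P) Q)
    (h : (phi 30 (f ⟨0, 1⟩) (gaussian_map_I_sq f))^[N] Q = origin 30) : IterEndsAt α P N 0 := by
  set φ := phi (30 : k) (f ⟨0, 1⟩) (gaussian_map_I_sq f) with hφ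
  have hφ0 : ∀ m, φ^[m] 0 = 0 := fun m => Function.iterate_fixed (map_zero φ) m
  have hsplit : ∀ j ≤ N, φ^[N - j] (φ^[j] Q) = origin 30 := fun j hj => by
    rw [← Function.iterate_add_apply, Nat.sub_add_cancel hj, h]
  have hne : ∀ j ≤ N, φ^[j] Q ≠ 0 := fun j hj h0 => by
    have := hsplit j hj
    rw [h0, hφ0] at this
    exact origin_ne_zero this.symm
  have hno : ∀ j < N, φ^[j] Q ≠ origin 30 := fun j hj h0 => by
    have := hsplit j hj.le
    rw [h0, show N - j = N - j - 1 + 1 by lia, Function.iterate_succ_apply, phi_origin, hφ0] at this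
    exact origin_ne_zero this.symm
  -- Residues are chosen for every `j`; beyond `N` the value 0 is only a filler.
  have hex : ∀ j, ∃ c : ResidueRing α, j ≤ N → ∃ y h, φ^[j] Q = mk (residueHom f hα c) y h := by
    intro j
    by_cases hj : j ≤ N
    · obtain ⟨x, y, e, he⟩ := exists_mk_of_ne_zero (hne j hj)
      obtain ⟨X, -, -, -, hX, -⟩ := (Red.iterate_phi f hQ j).of_eq_mk he
      obtain ⟨c, rfl⟩ := RedTo.exists_residue f hα hker hα0 hX
      exact ⟨c, fun _ => ⟨y, e, he⟩⟩
    · exact ⟨0, fun h0 => absurd h0 hj⟩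
  choose x hx using hex
  have hinj := residueHom_injective f hα hker
  refine ⟨x, ?_, fun j hj => ?_, ?_⟩
  · obtain ⟨y, e, he⟩ := hx 0 (by lia)
    obtain ⟨X, Y, E, hE, hX, -⟩ := hQ.of_eq_mk he
    exact ⟨X, Y, E, eq_affine_of_toTwist hE, RedTo.reducesTo f hα hker hα0 hX⟩
  · obtain ⟨y, e, he⟩ := hx j hj.le
    obtain ⟨y', e', he'⟩ := hx (j + 1) hj
    have hx0 : residueHom f hα (x j) ≠ 0 := by
      intro h0
      simp only [h0] at e he
      exact hno j hj (he.trans (mk_zero_left e))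
    have h2x : 2 * residueHom f hα (x j) ≠ 0 := mul_ne_zero (NeZero.ne _) hx0
    obtain ⟨e'', hp⟩ := phi_mk (gaussian_map_I_sq f) e hx0
    rw [Function.iterate_succ_apply', he, hφ, hp, mk_inj] at he'
    refine ⟨isUnit_of_residueHom_ne_zero f hα hker hα0 (by rwa [map_mul, map_ofNat]), hinj ?_⟩
    rw [map_mul, map_mul, map_mul, map_sub, map_pow, map_one, map_ofNat, residueHom_mk, ← he'.1]
    field_simp
  · obtain ⟨y, e, he⟩ := hx N le_rfl
    rw [h, origin, mk_inj] at he
    exact hinj (by rw [← he.1, map_zero])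

end Residue

/-! ### Homomorphisms from `ℤ[i]`, congruences and quadratic characters. -/

section GaussianHom

/-- The map sends `i` to `-M`, and therefore kills `M + i`. -/
theorem exists_gaussianHom {k : Type*} [Field k] {M : ℤ} (hM : (M : k) ^ 2 = -1) :
    ∃ f : GaussianInt →+* k, ∀ a b : ℤ, f ⟨a, b⟩ = (a - b * M : ℤ) := by
  refine ⟨Zsqrtd.lift ⟨-(M : k), by push_cast; linear_combination hM⟩, fun a b => ?_⟩
  simp only [Zsqrtd.lift_apply_apply]
  push_cast
  ring

theorem dvd_of_dvd_sub {S M a b : ℤ} (hS : M ^ 2 + 1 = S) (h : S ∣ a - b * M) :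
    (⟨M, 1⟩ : GaussianInt) ∣ ⟨a, b⟩ := by
  obtain ⟨t, ht⟩ := h
  refine ⟨⟨b + M * t, -t⟩, ?_⟩
  rw [Zsqrtd.ext_iff, Zsqrtd.re_mul, Zsqrtd.im_mul]
  constructor
  · dsimp only
    linear_combination ht - t * hS
  · dsimp only
    ring

end GaussianHom

section Congruences

variable {p n : ℕ} (hp : p.Prime) (hp10 : p % 10 = 1 ∨ p % 10 = 9)

theorem mod_five_eq (hp10 : p % 10 = 1 ∨ p % 10 = 9) : (p ^ 2 * 16 ^ n + 1) % 5 = 2 := by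
  have h1 : p % 5 = 1 ∨ p % 5 = 4 := by lia
  rcases h1 with h | h <;> simp [Nat.add_mod, Nat.mul_mod, Nat.pow_mod, h]

include hp hp10 in
theorem mod_three_eq : (p ^ 2 * 16 ^ n + 1) % 3 = 2 := by
  have h0 : p % 3 ≠ 0 := fun h => by
    have := (Nat.prime_dvd_prime_iff_eq Nat.prime_three hp).1 (Nat.dvd_of_mod_eq_zero h)
    lia
  have h1 : p % 3 = 1 ∨ p % 3 = 2 := by lia
  rcases h1 with h | h <;> simp [Nat.add_mod, Nat.mul_mod, Nat.pow_mod, h]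

theorem mod_eight_eq (hn : 1 ≤ n) : (p ^ 2 * 16 ^ n + 1) % 8 = 1 := by
  obtain ⟨m, rfl⟩ := Nat.exists_eq_add_of_le' hn
  rw [show p ^ 2 * 16 ^ (m + 1) + 1 = 8 * (p ^ 2 * 16 ^ m * 2) + 1 by ring]
  lia

end Congruences

section QuadraticCharacter

variable {S : ℕ} [Fact S.Prime] (h8 : S % 8 = 1) (h3 : S % 3 = 2) (h5 : S % 5 = 2)

include h8 in
theorem legendreSym_two : legendreSym S 2 = 1 := by
  have h2 : ((2 : ℤ) : ZMod S) ≠ 0 := by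
    intro h0
    rw [ZMod.intCast_zmod_eq_zero_iff_dvd] at h0
    have := Int.le_of_dvd (by norm_num) h0
    have := (Fact.out : S.Prime).two_le
    lia
  rw [legendreSym.eq_one_iff _ h2]
  have : S ≠ 2 := by lia
  exact_mod_cast (ZMod.exists_sq_eq_two_iff this).2 (Or.inl h8)

include h8 h3 in
-- As `S ≡ 1 (mod 4)`, reciprocity turns this into the fact that `S ≡ 2` is a nonsquare modulo 3.
theorem legendreSym_three : legendreSym S 3 = -1 := by
  rw [legendreSym.eq_neg_one_iff]
  have hdec : ¬IsSquare (2 : ZMod 3) := by decide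
  have : Fact (Nat.Prime 3) := ⟨Nat.prime_three⟩
  have h := ZMod.exists_sq_eq_prime_iff_of_mod_four_eq_one (p := S) (q := 3) (by lia) (by norm_num)
  have hs : (S : ZMod 3) = 2 := by
    rw [← ZMod.natCast_mod, h3]; rfl
  rw [hs] at h
  intro hsq
  exact hdec (h.1 (by exact_mod_cast hsq))

include h8 h5 in
theorem legendreSym_five : legendreSym S 5 = -1 := by
  rw [legendreSym.eq_neg_one_iff]
  have hdec : ¬IsSquare (2 : ZMod 5) := by decide
  have : Fact (Nat.Prime 5) := ⟨Nat.prime_five⟩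
  have h := ZMod.exists_sq_eq_prime_iff_of_mod_four_eq_one (p := S) (q := 5) (by lia) (by norm_num)
  have hs : (S : ZMod 5) = 2 := by
    rw [← ZMod.natCast_mod, h5]; rfl
  rw [hs] at h
  intro hsq
  exact hdec (h.1 (by exact_mod_cast hsq))

include h8 h3 h5 in
theorem thirty_pow_half : (30 : ZMod S) ^ (S / 2) = 1 := by
  have := legendreSym.eq_pow S 30
  rw [show (30 : ℤ) = 2 * 3 * 5 by norm_num, legendreSym.mul, legendreSym.mul, legendreSym_two h8,
    legendreSym_three h8 h3, legendreSym_five h8 h5] at this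
  norm_num at this
  exact this.symm

include h8 h3 in
theorem neg_twentyfour_pow_half : (-24 : ZMod S) ^ (S / 2) = -1 := by
  have := legendreSym.eq_pow S 24
  rw [show (24 : ℤ) = 2 * 2 * 2 * 3 by norm_num, legendreSym.mul, legendreSym.mul,
    legendreSym.mul, legendreSym_two h8, legendreSym_three h8 h3] at this
  norm_num at this
  -- `S / 2` is even because `S ≡ 1 (mod 8)`, so the sign of -24 does not matter.
  rw [Even.neg_pow ⟨S / 4, by lia⟩, ← this]

end QuadraticCharacter

/-! ### The two directions of the criterion. -/

open TwistPoint E30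

section PointFiveTwo

variable {k : Type*} [Field k] [NeZero (30 : k)] [NeZero (2 : k)]

theorem red_nsmul_point52 (f : GaussianInt →+* k) (p : ℕ) :
    Red f (toTwist (p • point52)) (p • mk (5 : k) 2 mk_five_two) := by
  rw [toTwist_nsmul]
  refine Red.nsmul (RedTo.ofNat 30) ?_ p
  exact Red.mk (h := mk_five_two) (RedTo.ofNat 5) (RedTo.ofNat 2)

end PointFiveTwo

theorem pointCongr_and_iterEndsAt_of_prime {p n : ℕ} (hn : 1 ≤ n)
    (h3 : (p ^ 2 * 16 ^ n + 1) % 3 = 2) (h5 : (p ^ 2 * 16 ^ n + 1) % 5 = 2)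
    (hS : (p ^ 2 * 16 ^ n + 1).Prime) :
    PointCongr ⟨(p : ℤ) * 4 ^ n, 1⟩
        ((⟨1, 1⟩ : GaussianInt) ^ (4 * n - 1) • (p • point52)) 0 0 ∧
      IterEndsAt ⟨(p : ℤ) * 4 ^ n, 1⟩ (p • point52) (4 * n - 1) 0 := by
  have h8 : (p ^ 2 * 16 ^ n + 1) % 8 = 1 := mod_eight_eq hn
  have hSM : (p * 4 ^ n) ^ 2 + 1 = p ^ 2 * 16 ^ n + 1 := by
    rw [mul_pow, ← pow_mul, mul_comm n, pow_mul]
    norm_num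
  generalize p ^ 2 * 16 ^ n + 1 = S at *
  have : Fact S.Prime := ⟨hS⟩
  -- The closure is needed for `√-24` and for the y-coordinate of the point that `1 + i` sends to
  -- `(5, 2)`.
  let k := AlgebraicClosure (ZMod S)
  have hcast : ∀ m : ℕ, S.Coprime m → NeZero (m : k) := fun m hm => ⟨fun h0 => by
    rw [CharP.cast_eq_zero_iff k S] at h0
    exact hS.one_lt.ne' (Nat.dvd_one.1 (hm.gcd_eq_one ▸ Nat.dvd_gcd dvd_rfl h0))⟩
  have hS2 : ¬2 ∣ S := by lia
  have hS3 : ¬3 ∣ S := by lia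
  have hS5 : ¬5 ∣ S := by lia
  have c2 := ((Nat.Prime.coprime_iff_not_dvd Nat.prime_two).2 hS2).symm
  have c3 := ((Nat.Prime.coprime_iff_not_dvd Nat.prime_three).2 hS3).symm
  have c5 := ((Nat.Prime.coprime_iff_not_dvd Nat.prime_five).2 hS5).symm
  have : NeZero (2 : k) := by exact_mod_cast hcast 2 c2
  have : NeZero (30 : k) := by exact_mod_cast hcast 30 ((c2.mul_right c3).mul_right c5)
  have hSM' : ((p : ℤ) * 4 ^ n) ^ 2 + 1 = S := by exact_mod_cast hSM
  have hMk : (((p : ℤ) * 4 ^ n : ℤ) : k) ^ 2 = -1 := by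
    have h0 : ((S : ℤ) : k) = 0 := by rw [Int.cast_natCast, CharP.cast_eq_zero]
    rw [← hSM', Int.cast_add, Int.cast_pow, Int.cast_one] at h0
    exact eq_neg_of_add_eq_zero_left h0
  obtain ⟨f, hf⟩ := exists_gaussianHom hMk
  have hα : f ⟨(p : ℤ) * 4 ^ n, 1⟩ = 0 := by rw [hf, one_mul, sub_self, Int.cast_zero]
  have hker : ∀ z, f z = 0 → ⟨(p : ℤ) * 4 ^ n, 1⟩ ∣ z := by
    rintro ⟨a, b⟩ hz
    rw [hf, CharP.intCast_eq_zero_iff k S] at hz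
    exact dvd_of_dvd_sub hSM' hz
  have hα0 : (⟨(p : ℤ) * 4 ^ n, 1⟩ : GaussianInt) ≠ 0 := fun h0 => by
    have := congrArg Zsqrtd.im h0
    simp at this
  have hI := hf 0 1
  have hj := gaussian_map_I_sq f
  have hpow : ∀ x : ZMod S, (algebraMap (ZMod S) k x) ^ S = algebraMap (ZMod S) k x := fun x => by
    rw [← map_pow, ZMod.pow_card]
  obtain ⟨r, hr⟩ : IsSquare (2 : ZMod S) := (ZMod.exists_sq_eq_two_iff (by lia)).2 (Or.inl h8)
  have h30 := congrArg (algebraMap (ZMod S) k) (thirty_pow_half h8 h3 h5)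
  have h24 := congrArg (algebraMap (ZMod S) k) (neg_twentyfour_pow_half h8 h3)
  rw [map_pow, map_ofNat, map_one] at h30
  rw [map_pow, map_neg, map_neg, map_ofNat, map_one] at h24
  have key := phi_iterate_eq_origin hj hn hS hSM (by
      rw [hI, zero_sub, one_mul, Int.cast_neg,
        show (p : ℤ) * 4 ^ n = ((p * 4 ^ n : ℕ) : ℤ) by push_cast; rfl, Int.cast_natCast,
        add_neg_cancel]) (by
      have := hpow ((0 - 1 * ((p : ℤ) * 4 ^ n) : ℤ) : ZMod S)
      rwa [map_intCast, ← hI] at this)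
    (r := algebraMap (ZMod S) k r) (by rw [← map_pow, pow_two, ← hr, map_ofNat]) (hpow r)
    (h := S / 2) (by lia) h30 h24
  have hred := red_nsmul_point52 f p
  refine ⟨pointCongr_of_red f hα hker hα0 ?_, iterEndsAt_of_red f hα hker hα0 hred key⟩
  rw [toTwist_pow_smul, ← key]
  exact Red.iterate_phi f hred _

theorem prime_of_forall_hom {p n : ℕ} (hn : 1 ≤ n) (hpn : p < 2 ^ n)
    (h3 : (p ^ 2 * 16 ^ n + 1) % 3 = 2) (h5 : (p ^ 2 * 16 ^ n + 1) % 5 = 2)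
    (hone : 1 < p ^ 2 * 16 ^ n + 1)
    (H : ∀ (q : ℕ) [Fact q.Prime] [NeZero (30 : ZMod q)] [NeZero (2 : ZMod q)]
      (f : GaussianInt →+* ZMod q), f ⟨(p : ℤ) * 4 ^ n, 1⟩ = 0 →
        (phi 30 (f ⟨0, 1⟩) (gaussian_map_I_sq f))^[4 * n - 1] (p • mk (5 : ZMod q) 2 mk_five_two) =
          origin 30) :
    (p ^ 2 * 16 ^ n + 1).Prime := by
  by_contra hS
  have h8 : (p ^ 2 * 16 ^ n + 1) % 8 = 1 := mod_eight_eq hn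
  have hSM : (p * 4 ^ n) ^ 2 + 1 = p ^ 2 * 16 ^ n + 1 := by
    rw [mul_pow, ← pow_mul, mul_comm n, pow_mul]
    norm_num
  have hq := Nat.minFac_prime hone.ne'
  have hqS := Nat.minFac_dvd (p ^ 2 * 16 ^ n + 1)
  have hqle := Nat.minFac_sq_le_self (by lia) hS
  generalize (p ^ 2 * 16 ^ n + 1).minFac = q at *
  have : Fact q.Prime := ⟨hq⟩
  have hne : ∀ m : ℕ, (p ^ 2 * 16 ^ n + 1).Coprime m → NeZero (m : ZMod q) :=
      fun m hm => ⟨fun h0 => by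
    rw [ZMod.natCast_eq_zero_iff] at h0
    exact hq.one_lt.ne' (Nat.dvd_one.1 (hm.gcd_eq_one ▸ Nat.dvd_gcd hqS h0))⟩
  generalize p ^ 2 * 16 ^ n + 1 = S at *
  have hS2 : ¬2 ∣ S := by lia
  have hS3 : ¬3 ∣ S := by lia
  have hS5 : ¬5 ∣ S := by lia
  have c2 := ((Nat.Prime.coprime_iff_not_dvd Nat.prime_two).2 hS2).symm
  have c3 := ((Nat.Prime.coprime_iff_not_dvd Nat.prime_three).2 hS3).symm
  have c5 := ((Nat.Prime.coprime_iff_not_dvd Nat.prime_five).2 hS5).symm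
  have : NeZero (2 : ZMod q) := by exact_mod_cast hne 2 c2
  have : NeZero (30 : ZMod q) := by exact_mod_cast hne 30 ((c2.mul_right c3).mul_right c5)
  have hMk : (((p : ℤ) * 4 ^ n : ℤ) : ZMod q) ^ 2 = -1 := by
    have := (ZMod.natCast_eq_zero_iff S q).2 hqS
    rw [← hSM, Nat.cast_add, Nat.cast_pow, Nat.cast_one] at this
    rw [← eq_neg_of_add_eq_zero_left this]
    push_cast
    rfl
  obtain ⟨f, hf⟩ := exists_gaussianHom hMk
  have hα : f ⟨(p : ℤ) * 4 ^ n, 1⟩ = 0 := by rw [hf, one_mul, sub_self, Int.cast_zero]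
  have key := H q f hα
  obtain ⟨hfin, hcard⟩ := TwistPoint.card_le (c := (30 : ZMod q))
  have hge := two_pow_le_card_of_iterate (phi (30 : ZMod q) (f ⟨0, 1⟩) (gaussian_map_I_sq f))
    (p • mk (5 : ZMod q) 2 mk_five_two) (4 * n - 1) (by rw [key]; exact origin_ne_zero)
    (by rw [Function.iterate_succ_apply', key, phi_origin])
  rw [Nat.card_zmod] at hcard
  -- The least prime factor satisfies `q² ≤ S = M² + 1 < (M + 1)²`.
  have hqM : q ≤ p * 4 ^ n := by
    by_contra hlt
    have : (p * 4 ^ n + 1) ^ 2 ≤ q ^ 2 := Nat.pow_le_pow_left (by lia) 2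
    have hM : 0 < p * 4 ^ n := by
      rw [Nat.pos_iff_ne_zero]
      intro h0
      rw [h0] at hSM
      lia
    nlinarith
  have h16 : 2 ^ (4 * n - 1 + 1) = 2 ^ n * (2 ^ n * 4 ^ n) := by
    rw [show 4 * n - 1 + 1 = n + (n + 2 * n) by lia, pow_add, pow_add, pow_mul 2 2 n]
    norm_num
  have h2n : 2 ≤ 2 ^ n := by
    calc 2 = 2 ^ 1 := rfl
      _ ≤ 2 ^ n := Nat.pow_le_pow_right (by norm_num) hn
  have h4n : 4 ≤ 4 ^ n := by
    calc 4 = 4 ^ 1 := rfl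
      _ ≤ 4 ^ n := Nat.pow_le_pow_right (by norm_num) hn
  -- From `p + 1 ≤ 2ⁿ` comes `M + 4ⁿ ≤ 8ⁿ`, hence `2 (q + 1) ≤ 2 (M + 1) < 2 · 8ⁿ ≤ 16ⁿ`, against
  -- the lower bound `16ⁿ`.
  have h1 : p * 4 ^ n + 4 ^ n ≤ 2 ^ n * 4 ^ n := by
    rw [← Nat.succ_mul]
    exact Nat.mul_le_mul_right _ hpn
  have h2 : 2 * (2 ^ n * 4 ^ n) ≤ 2 ^ n * (2 ^ n * 4 ^ n) := Nat.mul_le_mul_right _ h2n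
  lia

theorem theorem2p12 (p n : ℕ) (hp : p.Prime) (hp10 : p % 10 = 1 ∨ p % 10 = 9) (hpn : p < 2 ^ n) :
    (Nat.Prime (p ^ 2 * 16 ^ n + 1) ↔
      PointCongr ⟨(p : ℤ) * 4 ^ n, 1⟩
        ((⟨1, 1⟩ : GaussianInt) ^ (4 * n - 1) • (p • point52)) 0 0) ∧
    (Nat.Prime (p ^ 2 * 16 ^ n + 1) ↔
      IterEndsAt ⟨(p : ℤ) * 4 ^ n, 1⟩ (p • point52) (4 * n - 1) 0) := by
  have hn : 1 ≤ n := by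
    by_contra hn
    obtain rfl : n = 0 := by lia
    have := hp.two_le
    lia
  have h3 := mod_three_eq (n := n) hp hp10
  have h5 := mod_five_eq (n := n) hp10
  have hone : 1 < p ^ 2 * 16 ^ n + 1 := by
    have := hp.pos
    have : 0 < p ^ 2 * 16 ^ n := by positivity
    lia
  have hfwd := pointCongr_and_iterEndsAt_of_prime hn h3 h5
  refine ⟨⟨fun hS => (hfwd hS).1, fun h => ?_⟩, ⟨fun hS => (hfwd hS).2, fun h => ?_⟩⟩
  · refine prime_of_forall_hom hn hpn h3 h5 hone fun q _ _ _ f hα => ?_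
    refine PointCongr.eq_origin f hα h ?_
    rw [toTwist_pow_smul]
    exact Red.iterate_phi f (red_nsmul_point52 f p) _
  · refine prime_of_forall_hom hn hpn h3 h5 hone fun q _ _ _ f hα => ?_
    exact IterEndsAt.iterate_eq_origin f hα h (red_nsmul_point52 f p)
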